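/- **Theorem.** Let $X_0$ be a single edge of length $1$, identified with $[0,1]$, and let $X_{n+1}$ be obtained from $X_n$ by replacing every edge (of length $4^{-n}$) by a copy of the diamond graph with edges of length $4^{-n-1}$. Here the diamond graph has vertices $a,p,t,b,q,z$ and edges $1=ap$, $2=pt$, $3=tq$, $4=pb$, $5=bq$, $6=qz$; the ends $a,z$ are placed at the ends of the replaced edge, whose orientation from $a$ to $z$ is the one inherited from $[0,1]$. Give each $X_n$ its length distance, and let $\pi_{n+1,n}:X_{n+1}\to X_n$ be the map that collapses each diamond onto the edge that it replaces: edge $1$ is mapped onto the first quarter, edges $2,4$ onto the second, edges $3,5$ onto the third and edge $6$ onto the last quarter. For $w\in(0,1)$ let $\mu_{w,n}$ be the probability measure on $X_n$ that is a multiple of arclength on each edge, where $\mu_{w,0}$ is Lebesgue measure on $[0,1]$ and the six edges $1,\dots,6$ of $X_{n+1}$ that replace an edge $e$ of $X_n$ have $\mu_{w,n+1}$-mass $\tfrac14,\tfrac w4,\tfrac w4,\tfrac{1-w}4,\tfrac{1-w}4,\tfrac14$ times $\mu_{w,n}(e)$, respectively. Then there are a compact geodesic metric space $(X,d)$, maps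 $\pi_{\infty,n}:X\to X_n$ $(n\ge 0)$ and Borel probability measures $\mu_w$ on $X$ $(w\in(0,1))$ such that 1. $X$ is the inverse limit of the diamond graphs: $\pi_{n+1,n}\circ\pi_{\infty,n+1}=\pi_{\infty,n}$ for all $n$; for every sequence $z_n\in X_n$ with $\pi_{n+1,n}(z_{n+1})=z_n$ for all $n$ there is exactly one $x\in X$ with $\pi_{\infty,n}(x)=z_n$ for all $n$; and $d(x,y)=\lim_{n\to\infty}d_{X_n}(\pi_{\infty,n}(x),\pi_{\infty,n}(y))$ for all $x,y\in X$. 2. $(\pi_{\infty,n})_\ast\mu_w=\mu_{w,n}$ for all $n\ge 0$ and $w\in(0,1)$. 3. Each $\mu_w$ is doubling: there is $C=C(w)$ such that $0<\mu_w(B(x,2r))\le C\,\mu_w(B(x,r))<\infty$ for all $x\in X$, $r>0$. 4. Each $(X,\mu_w)$ supports a $(1,1)$-Poincaré inequality: there are $C=C(w)\ge 0$ and $\Lambda=\Lambda(w)\ge1$ such that for every locally $\mu_w$-integrable $u:X\to\mathbb R$, every upper gradient $g$ of $u$ and every ball $B=B(x,r)$, $$\frac1{\mu_w(B)}\int_B|u-u_B|\,d\mu_w\le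 C\,r\,\frac1{\mu_w(B(x,\Lambda r))}\int_{B(x,\Lambda r)}g\,d\mu_w,\qquad u_B=\frac1{\mu_w(B)}\int_Bu\,d\mu_w.$$ An upper gradient of $u$ is a Borel function $g:X\to[0,\infty]$ such that $|u(\gamma(l))-u(\gamma(0))|\le\int_0^l g(\gamma(s))\,ds$ for every rectifiable curve $\gamma:[0,l]\to X$ parametrized by arclength. 5. If $w\ne w'$, the measures $\mu_w$ and $\mu_{w'}$ are mutually singular. -/

import Mathlib

open MeasureTheory Filter
open scoped NNReal ENNReal Topology

/-! ## Metric graphs with edges of equal length -/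

/-- A directed multigraph all of whose edges have length `len`. -/
structure LenGraph where
  V : Type
  E : Type
  src : E → V
  tgt : E → V
  len : ℝ≥0

namespace LenGraph

/-- A point on a marked edge, `pos` being the affine coordinate (`0` at the source of the edge,
`1` at its target). Points at a common vertex are identified later, by the metric. -/
@[ext] structure Point (G : LenGraph) where
  edge : G.E
  pos : unitInterval

/-- `p` is an end point of its edge, located at the vertex `v`. -/
def Point.At {G : LenGraph} (p : G.Point) (v : G.V) : Prop :=
  (p.pos = 0 ∧ G.src p.edge = v) ∨ (p.pos = 1 ∧ G.tgt p.edge = v)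

/-- `G.Joins p q L`: some piecewise linear path in `G` of length `L` goes from `p` to `q`. -/
inductive Joins (G : LenGraph) : G.Point → G.Point → ℝ≥0 → Prop
  | refl (p : G.Point) : Joins G p p 0
  | glue (p q : G.Point) (v : G.V) (hp : p.At v) (hq : q.At v) : Joins G p q 0
  | segment (e : G.E) (s t : unitInterval) : Joins G ⟨e, s⟩ ⟨e, t⟩ (G.len * nndist s t)
  | trans {p q r : G.Point} {a b : ℝ≥0} :
      Joins G p q a → Joins G q r b → Joins G p r (a + b)

theorem Joins.symm {G : LenGraph} {p q : G.Point} {L : ℝ≥0} (h : G.Joins p q L) :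
    G.Joins q p L := by
  induction h with
  | refl p => exact .refl p
  | glue p q v hp hq => exact .glue q p v hq hp
  | segment e s t => rw [nndist_comm]; exact .segment e t s
  | trans _ _ h1 h2 => rw [add_comm]; exact .trans h2 h1

/-- The length (extended) distance: the infimum of the lengths of the paths from `p` to `q`. -/
noncomputable def lengthDist (G : LenGraph) (p q : G.Point) : ℝ≥0∞ :=
  ⨅ (L : ℝ≥0) (_ : G.Joins p q L), (L : ℝ≥0∞)

theorem lengthDist_le {G : LenGraph} {p q : G.Point} {L : ℝ≥0} (h : G.Joins p q L) :
    G.lengthDist p q ≤ L := iInf₂_le L h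

noncomputable instance (G : LenGraph) : PseudoEMetricSpace G.Point where
  edist := G.lengthDist
  edist_self p := by
    have := lengthDist_le (Joins.refl p)
    simpa using this
  edist_comm p q := by
    have key : ∀ p q : G.Point, G.lengthDist p q ≤ G.lengthDist q p :=
      fun p q => le_iInf₂ fun L h => lengthDist_le h.symm
    exact le_antisymm (key p q) (key q p)
  edist_triangle p q r := by
    unfold lengthDist
    refine ENNReal.le_of_forall_pos_le_add fun ε hε hfin => ?_
    have hε2 : (ε / 2 : ℝ≥0) ≠ 0 := by positivity
    obtain ⟨h1, h2⟩ := ENNReal.add_lt_top.1 hfin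
    have e1 := ENNReal.lt_add_right h1.ne (ENNReal.coe_ne_zero.2 hε2)
    have e2 := ENNReal.lt_add_right h2.ne (ENNReal.coe_ne_zero.2 hε2)
    obtain ⟨a, ha⟩ := iInf_lt_iff.1 e1
    obtain ⟨ja, ha⟩ := iInf_lt_iff.1 ha
    obtain ⟨b, hb⟩ := iInf_lt_iff.1 e2
    obtain ⟨jb, hb⟩ := iInf_lt_iff.1 hb
    calc (⨅ (L : ℝ≥0) (_ : G.Joins p r L), (L : ℝ≥0∞))
        ≤ ((a + b : ℝ≥0) : ℝ≥0∞) := iInf₂_le (a + b) (ja.trans jb)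
      _ = a + b := by push_cast; rfl
      _ ≤ _ := add_le_add ha.le hb.le
      _ = _ := by
        rw [add_add_add_comm, ← ENNReal.coe_add, add_halves]

/-- The geometric realization of `G` with its length distance: points at distance zero (that is,
the ends of edges that meet at a common vertex) are identified. -/
abbrev Space (G : LenGraph) : Type := SeparationQuotient G.Point

/-- The point with coordinate `s` on the edge `e` of the realization. -/
noncomputable def Space.mk (G : LenGraph) (e : G.E) (s : unitInterval) : G.Space :=
  SeparationQuotient.mk (⟨e, s⟩ : G.Point)

noncomputable instance (G : LenGraph) : MeasurableSpace G.Space := borel _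

instance (G : LenGraph) : BorelSpace G.Space := ⟨rfl⟩

/-! ## The diamond substitution -/

/-- The graph with two vertices and one edge, of length `1`. -/
def unitSegment : LenGraph where
  V := Bool
  E := Unit
  src _ := false
  tgt _ := true
  len := 1

/-- Replace every edge `e` of `G` by a copy of the diamond graph, scaled so that its six edges
have a quarter of the length of `e`. The new vertices of the copy are `(e, 0)`, at a quarter of
the way, `(e, 1)` (top) and `(e, 2)` (bottom), at half of the way, and `(e, 3)`, at three quarters
of the way. The six edges are
`0 : src e → (e, 0)`, `1 : (e, 0) → (e, 1)`, `2 : (e, 1) → (e, 3)`,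
`3 : (e, 0) → (e, 2)`, `4 : (e, 2) → (e, 3)`, `5 : (e, 3) → tgt e`. -/
noncomputable def diamond (G : LenGraph) : LenGraph where
  V := G.V ⊕ (G.E × Fin 4)
  E := G.E × Fin 6
  src a := (![.inl (G.src a.1), .inr (a.1, 0), .inr (a.1, 1),
    .inr (a.1, 0), .inr (a.1, 2), .inr (a.1, 3)] : Fin 6 → G.V ⊕ (G.E × Fin 4)) a.2
  tgt a := (![.inr (a.1, 0), .inr (a.1, 1), .inr (a.1, 3),
    .inr (a.1, 2), .inr (a.1, 3), .inl (G.tgt a.1)] : Fin 6 → G.V ⊕ (G.E × Fin 4)) a.2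
  len := G.len / 4

/-- Which quarter of the old edge the new edge with the given label covers. -/
def quarter : Fin 6 → ℕ := ![0, 1, 2, 1, 2, 3]

theorem quarter_le (i : Fin 6) : quarter i ≤ 3 := by
  fin_cases i <;> simp [quarter]

/-- The coordinate on the old edge of the point with coordinate `s` on the `i`-th new edge. -/
noncomputable def quarterPos (i : Fin 6) (s : unitInterval) : unitInterval :=
  ⟨(quarter i + (s : ℝ)) / 4, by
    have h : (quarter i : ℝ) ≤ 3 := by exact_mod_cast quarter_le i
    have h0 : (0 : ℝ) ≤ quarter i := Nat.cast_nonneg _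
    constructor <;> linarith [s.2.1, s.2.2]⟩

/-- The map that collapses each diamond to the edge that it replaces, on marked points. -/
noncomputable def collapsePoint (G : LenGraph) (p : G.diamond.Point) : G.Point :=
  ⟨p.edge.1, quarterPos p.edge.2 p.pos⟩

/-- Where the collapsing map sends the vertices of the new graph. -/
theorem collapsePoint_at {G : LenGraph} {p : G.diamond.Point} {v : G.diamond.V} (h : p.At v) :
    (∃ u : G.V, v = Sum.inl u ∧ (G.collapsePoint p).At u) ∨
    (∃ (e : G.E) (k : Fin 4), v = Sum.inr (e, k) ∧
      (G.collapsePoint p).edge = e ∧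
        ((G.collapsePoint p).pos : ℝ) = (![1 / 4, 1 / 2, 1 / 2, 3 / 4] : Fin 4 → ℝ) k) := by
  obtain ⟨⟨e, i⟩, s⟩ := p
  rcases h with ⟨hs, hv⟩ | ⟨hs, hv⟩ <;> dsimp only at hs hv <;> subst hs <;> subst hv <;>
    fin_cases i <;>
    simp [diamond, collapsePoint, quarterPos, quarter, Point.At, Subtype.ext_iff] <;> norm_num

theorem Joins.collapse {G : LenGraph} {p q : G.diamond.Point} {L : ℝ≥0}
    (h : G.diamond.Joins p q L) : G.Joins (G.collapsePoint p) (G.collapsePoint q) L := by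
  induction h with
  | refl p => exact .refl _
  | glue p q v hp hq =>
    rcases collapsePoint_at hp with ⟨u, hu, hpu⟩ | ⟨e, k, hk, he, hpos⟩ <;>
    rcases collapsePoint_at hq with ⟨u', hu', hqu⟩ | ⟨e', k', hk', he', hpos'⟩
    · obtain rfl : u = u' := Sum.inl.inj (hu.symm.trans hu')
      exact .glue _ _ u hpu hqu
    · exact absurd (hu.symm.trans hk') (by simp)
    · exact absurd (hk.symm.trans hu') (by simp)
    · obtain ⟨rfl, rfl⟩ := Prod.mk.inj (Sum.inr.inj (hk.symm.trans hk'))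
      have : G.collapsePoint p = G.collapsePoint q :=
        Point.ext (he.trans he'.symm) (Subtype.ext (hpos.trans hpos'.symm))
      rw [this]
      exact .refl _
  | segment e s t =>
    have hlen : G.diamond.len * nndist s t
        = G.len * nndist (quarterPos e.2 s) (quarterPos e.2 t) := by
      ext
      have hd : (dist (quarterPos e.2 s) (quarterPos e.2 t) : ℝ) = dist s t / 4 := by
        rw [Subtype.dist_eq, Subtype.dist_eq, Real.dist_eq, Real.dist_eq]
        simp only [quarterPos]
        rw [← sub_div, abs_div, add_sub_add_left_eq_sub, abs_of_pos (by norm_num : (0 : ℝ) < 4)]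
      simp only [NNReal.coe_mul, coe_nndist, hd, diamond, NNReal.coe_div]
      push_cast
      ring
    rw [hlen]
    exact .segment e.1 _ _
  | trans _ _ h1 h2 => exact h1.trans h2

theorem lipschitzWith_collapsePoint (G : LenGraph) : LipschitzWith 1 G.collapsePoint := by
  intro p q
  rw [ENNReal.coe_one, one_mul]
  exact le_iInf₂ fun L h => lengthDist_le h.collapse

/-- The map that collapses each diamond to the edge that it replaces. -/
noncomputable def collapse (G : LenGraph) : G.diamond.Space → G.Space :=
  SeparationQuotient.lift (fun p => SeparationQuotient.mk (G.collapsePoint p)) fun _ _ h =>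
    SeparationQuotient.mk_eq_mk.2 (h.map G.lipschitzWith_collapsePoint.continuous)

end LenGraph

/-! ## The sequence of diamond graphs, its inverse limit, and the measures -/

namespace Laakso

/-- The `n`-th graph of the sequence; its edges have length `4⁻ⁿ`. -/
noncomputable def graph : ℕ → LenGraph
  | 0 => LenGraph.unitSegment
  | n + 1 => (graph n).diamond

/-- The projection from the `(n + 1)`-st to the `n`-th graph. -/
noncomputable def proj (n : ℕ) : (graph (n + 1)).Space → (graph n).Space := (graph n).collapse

/-- `X`, with the maps `π n`, is the inverse limit of the diamond graphs, and its distance is the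
limit of the length distances of the graphs. -/
structure IsLimit (X : Type) [MetricSpace X] (π : ∀ n, X → (graph n).Space) : Prop where
  compat : ∀ n x, proj n (π (n + 1) x) = π n x
  existsUnique : ∀ z : ∀ n, (graph n).Space, (∀ n, proj n (z (n + 1)) = z n) →
    ∃! x : X, ∀ n, π n x = z n
  tendsto_edist : ∀ x y : X, Tendsto (fun n => edist (π n x) (π n y)) atTop (𝓝 (edist x y))

/-- The fraction of the mass of an edge that goes to each of the six edges replacing it. -/
noncomputable def split (w : ℝ) : Fin 6 → ℝ≥0∞ := fun i =>
  ENNReal.ofReal ((![1 / 4, w / 4, w / 4, (1 - w) / 4, (1 - w) / 4, 1 / 4] : Fin 6 → ℝ) i)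

/-- The mass that the measure with parameter `w` gives to each edge of the `n`-th graph. -/
noncomputable def edgeMass (w : ℝ) : ∀ n, (graph n).E → ℝ≥0∞
  | 0, _ => 1
  | n + 1, a => edgeMass w n a.1 * split w a.2

/-- The measure on the `n`-th graph that is a multiple of arclength on each edge, with total mass
`edgeMass w n e` on the edge `e`. -/
noncomputable def graphMeasure (w : ℝ) (n : ℕ) : Measure (graph n).Space :=
  Measure.sum fun e : (graph n).E =>
    edgeMass w n e • (volume : Measure unitInterval).map (LenGraph.Space.mk (graph n) e)

end Laakso

/-! ## Metric measure spaces -/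

/-- Any two points are the ends of an isometric image of a segment. -/
def IsGeodesicSpace (X : Type*) [MetricSpace X] : Prop :=
  ∀ x y : X, ∃ γ : ℝ → X, γ 0 = x ∧ γ (dist x y) = y ∧
    ∀ s ∈ Set.Icc 0 (dist x y), ∀ t ∈ Set.Icc 0 (dist x y), dist (γ s) (γ t) = |s - t|

/-- Balls have positive finite measure, and doubling the radius of a ball increases its measure at
most by a constant factor. -/
def IsDoublingMeasure {X : Type*} [MetricSpace X] [MeasurableSpace X] (μ : Measure X) : Prop :=
  ∃ C : ℝ≥0, ∀ (x : X) (r : ℝ), 0 < r →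
    0 < μ (Metric.ball x r) ∧ μ (Metric.ball x r) < ∞ ∧
      μ (Metric.ball x (2 * r)) ≤ C * μ (Metric.ball x r)

/-- `g` is an upper gradient of `u`: it is Borel, and the variation of `u` between the ends of a
rectifiable curve, parametrized by arclength, is at most the integral of `g` along the curve. -/
def IsUpperGradient {X : Type*} [MetricSpace X] [MeasurableSpace X] (g : X → ℝ≥0∞) (u : X → ℝ) :
    Prop :=
  Measurable g ∧ ∀ (l : ℝ) (γ : ℝ → X), 0 ≤ l → HasUnitSpeedOn γ (Set.Icc 0 l) →
    ENNReal.ofReal |u (γ l) - u (γ 0)| ≤ ∫⁻ t in Set.Icc 0 l, g (γ t)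

/-- The `(1,1)`-Poincaré inequality: on every ball the mean oscillation of a locally integrable
function is bounded by the radius times the mean of an upper gradient on a fixed dilate. -/
def SupportsPoincareOneOne {X : Type*} [MetricSpace X] [MeasurableSpace X] (μ : Measure X) :
    Prop :=
  ∃ (C : ℝ≥0) (Λ : ℝ), 1 ≤ Λ ∧
    ∀ (u : X → ℝ) (g : X → ℝ≥0∞), LocallyIntegrable u μ → IsUpperGradient g u →
      ∀ (x : X) (r : ℝ), 0 < r →
        (⨍⁻ y in Metric.ball x r, ENNReal.ofReal |u y - ⨍ z in Metric.ball x r, u z ∂μ| ∂μ) ≤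
          C * ENNReal.ofReal r * ⨍⁻ y in Metric.ball x (Λ * r), g y ∂μ

/-!
Everything rests on one parametrization. The collapsing map `G.diamond → G` has two sections, which
run through the top, respectively the bottom, branch of every diamond; both are `1`-Lipschitz, and
every point of `G.diamond` is on one of them. Starting from a height `t ∈ [0, 1]` and applying
section number `b k` in generation `k`, one obtains the point `Laakso.Limit.point t b` of the
inverse limit; every point is of this form. For fixed `b` this is an isometric embedding of
`[0, 1]`, a monotone geodesic. Two choices `b`, `c` lead to the same point at height `τ` exactly if
they agree in every generation `k` for which `τ` is strictly between the ends of the branches of a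
diamond of that generation (`Laakso.Agree`), and
`d (point s b, point t c) = min {|s - τ| + |τ - t| : Agree τ b c}`.
The lower bound `Laakso.exists_agree_le_edist_param` is the only place where paths in the graphs
have to be understood: it comes from the distance in the cycle formed by the branches of the first
diamond that separates the two points, extended to a `1`-Lipschitz function on the graph
(`LenGraph.le_edist_lift`). The formula gives geodesics, by concatenating two monotone ones at `τ`,
and the continuity of the parametrization on the compact space `[0, 1] × {0, 1}^ℕ`, hence
compactness.

The measure with parameter `w` is the image of the product of Lebesgue measure and independent
choices of branches, top with probability `w`. By the distance formula every ball is contained in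
the star of a vertex (`Laakso.Limit.exists_ball_subset_star`), and in the parametrization a star is
the product of an interval of heights and the cylinder of choices which agree at the vertex. So its
mass is explicit. Comparing stars at nearby vertices of consecutive generations changes the
prescribed choices in a bounded number of generations, which gives doubling. For the Poincaré
inequality, all points of a star are joined to its centre by monotone geodesics, so the upper
gradient inequality and Fubini's theorem bound the mean oscillation on the star by the integral of
the upper gradient on the same star (`Laakso.Limit.lintegral_star_le`). Finally, the events that a
point lies in the top branch of a diamond of generation `n` are independent of each other and have
probability `w / 2`, so by the law of large numbers `w` can be read off almost every point, and
different parameters give mutually singular measures.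
-/


/-! ### Sections of the collapsing map -/

namespace Laakso

/-- The quarter of the unit interval that contains `s`, the common end of two quarters being given
to the upper one. -/
noncomputable def digit (s : unitInterval) : Fin 4 :=
  if (s : ℝ) < 1 / 4 then 0 else if (s : ℝ) < 1 / 2 then 1 else if (s : ℝ) < 3 / 4 then 2 else 3

theorem digit_le (s : unitInterval) : ((digit s : ℕ) : ℝ) ≤ 4 * s := by
  have := s.2.1
  unfold digit
  split_ifs <;> simp <;> linarith

theorem le_digit_add_one (s : unitInterval) : 4 * (s : ℝ) ≤ (digit s : ℕ) + 1 := by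
  have := s.2.2
  unfold digit
  split_ifs <;> simp <;> linarith

theorem digit_eq {s : unitInterval} {d : Fin 4} (h0 : ((d : ℕ) : ℝ) ≤ 4 * s)
    (h1 : 4 * (s : ℝ) < (d : ℕ) + 1) : digit s = d := by
  unfold digit
  fin_cases d <;> simp at h0 h1 <;> split_ifs <;> first | rfl | (exfalso; linarith)

theorem digit_one : digit 1 = 3 := by
  unfold digit
  norm_num

theorem digit_mono {s t : unitInterval} (h : s ≤ t) : digit s ≤ digit t := by
  have h' : (s : ℝ) ≤ t := h
  unfold digit
  split_ifs <;> first | decide | (exfalso; linarith)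

/-- The coordinate, in the quarter of the unit interval that contains `s`, of the point `s`. -/
noncomputable def stretch (s : unitInterval) : unitInterval :=
  ⟨4 * s - (digit s : ℕ), by linarith [digit_le s], by linarith [le_digit_add_one s]⟩

@[simp] theorem coe_stretch (s : unitInterval) : (stretch s : ℝ) = 4 * s - (digit s : ℕ) := rfl

/-- The new edge that covers the quarter `d` of the old one and, if `d` is one of the two middle
quarters, lies on the top (`β = true`) or bottom (`β = false`) branch of the diamond. -/
def label (d : Fin 4) (β : Bool) : Fin 6 :=
  match d, β with
  | 0, _ => 0
  | 1, true => 1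
  | 1, false => 3
  | 2, true => 2
  | 2, false => 4
  | 3, _ => 5

@[simp] theorem quarter_label (d : Fin 4) (β : Bool) : LenGraph.quarter (label d β) = d := by
  fin_cases d <;> cases β <;> rfl

theorem exists_label (i : Fin 6) : ∃ d β, label d β = i := by
  fin_cases i
  exacts [⟨0, true, rfl⟩, ⟨1, true, rfl⟩, ⟨2, true, rfl⟩, ⟨1, false, rfl⟩, ⟨2, false, rfl⟩,
    ⟨3, true, rfl⟩]

theorem label_congr {d : Fin 4} (h : d = 0 ∨ d = 3) (β β' : Bool) : label d β = label d β' := by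
  rcases h with rfl | rfl <;> cases β <;> cases β' <;> rfl

end Laakso

namespace LenGraph

open Laakso

variable {G : LenGraph}

/-- The edge with label `i` among the six edges that replace the edge `e`. -/
def newEdge (e : G.E) (i : Fin 6) : G.diamond.E := (e, i)

theorem exists_newEdge (a : G.diamond.E) : ∃ (e : G.E) (i : Fin 6), newEdge e i = a :=
  ⟨a.1, a.2, rfl⟩

theorem Space.edist_mk_le (e : G.E) (s t : unitInterval) :
    edist (Space.mk G e s) (Space.mk G e t) ≤ ENNReal.ofReal (G.len * |(s : ℝ) - t|) := by
  refine (lengthDist_le (Joins.segment e s t)).trans (le_of_eq ?_)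
  rw [ENNReal.ofReal, ENNReal.coe_inj]
  ext
  rw [Real.coe_toNNReal _ (by positivity)]
  simp [Subtype.dist_eq, Real.dist_eq]

theorem Space.mk_eq_mk {e e' : G.E} {s s' : unitInterval} {v : G.V}
    (h : Point.At ⟨e, s⟩ v) (h' : Point.At ⟨e', s'⟩ v) : Space.mk G e s = Space.mk G e' s' := by
  refine SeparationQuotient.mk_eq_mk.2 (EMetric.inseparable_iff.2 ?_)
  exact le_antisymm ((lengthDist_le (Joins.glue _ _ v h h')).trans (by simp)) zero_le

theorem Space.exists_mk (z : G.Space) : ∃ e s, Space.mk G e s = z := by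
  obtain ⟨p, rfl⟩ := SeparationQuotient.surjective_mk z
  exact ⟨p.edge, p.pos, rfl⟩

theorem Space.continuous_mk (e : G.E) : Continuous (Space.mk G e) := by
  refine LipschitzWith.continuous (K := G.len) fun s t => ?_
  refine (Space.edist_mk_le e s t).trans (le_of_eq ?_)
  rw [ENNReal.ofReal_mul (NNReal.coe_nonneg _), edist_dist, Subtype.dist_eq, Real.dist_eq]
  simp

/-- The section `LenGraph.lift` of the collapsing map, on marked points. -/
noncomputable def liftPoint (β : Bool) (p : G.Point) : G.diamond.Point :=
  ⟨newEdge p.edge (label (digit p.pos) β), stretch p.pos⟩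

/-- The ends of consecutive edges on one branch of a diamond coincide. -/
theorem mk_label_one (e : G.E) (β : Bool) {d d' : Fin 4} (h : (d' : ℕ) = d + 1) :
    Space.mk G.diamond (newEdge e (label d β)) 1 =
      Space.mk G.diamond (newEdge e (label d' β)) 0 := by
  refine Space.mk_eq_mk (v := G.diamond.tgt (newEdge e (label d β))) (.inr ⟨rfl, rfl⟩)
    (.inl ⟨rfl, ?_⟩)
  fin_cases d <;> fin_cases d' <;> simp at h <;> cases β <;> simp [diamond, label, newEdge]

theorem coe_diamond_len : (G.diamond.len : ℝ) = G.len / 4 := by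
  simp [diamond]

theorem edist_lift_le (β : Bool) (e : G.E) (s t : unitInterval) :
    edist (Space.mk G.diamond (newEdge e (label (digit s) β)) (stretch s))
      (Space.mk G.diamond (newEdge e (label (digit t) β)) (stretch t)) ≤
      ENNReal.ofReal (G.len * |(s : ℝ) - t|) := by
  -- Induction on the number of quarters between `s` and `t`.
  have key : ∀ (k : ℕ) (s t : unitInterval), s ≤ t → ((digit t : ℕ) = digit s + k) →
      edist (Space.mk G.diamond (newEdge e (label (digit s) β)) (stretch s))
        (Space.mk G.diamond (newEdge e (label (digit t) β)) (stretch t)) ≤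
        ENNReal.ofReal (G.len * (t - s)) := by
    intro k
    induction k with
    | zero =>
      intro s t hst h
      have hd : digit t = digit s := Fin.ext (by simpa using h)
      have hst' : (s : ℝ) ≤ t := hst
      rw [hd]
      refine (Space.edist_mk_le _ _ _).trans (le_of_eq ?_)
      rw [coe_stretch, coe_stretch, hd, coe_diamond_len, abs_of_nonpos (by linarith)]
      ring_nf
    | succ k ih =>
      intro s t hst h
      have hd4 := (digit t).2
      have hs4 : (digit s : ℕ) + 1 < 4 := by omega
      have hs4' : ((digit s : ℕ) : ℝ) + 1 ≤ 3 := by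
        exact_mod_cast (by omega : (digit s : ℕ) + 1 ≤ 3)
      let m : unitInterval := ⟨(((digit s : ℕ) : ℝ) + 1) / 4, by positivity, by linarith⟩
      have hm : digit m = ⟨digit s + 1, hs4⟩ := by
        apply digit_eq <;> simp [m] <;> linarith
      have hm0 : stretch m = 0 := by
        ext
        simp [hm, m]
        ring
      have hmt : (m : ℝ) ≤ t := by
        have h1 := digit_le t
        have h2 : ((digit s : ℕ) : ℝ) + 1 ≤ (digit t : ℕ) := by
          exact_mod_cast (by omega : (digit s : ℕ) + 1 ≤ digit t)
        simp only [m]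
        linarith
      have hsm : (s : ℝ) ≤ m := by
        have := le_digit_add_one s
        simp only [m]
        linarith
      have h2 := ih m t hmt (by rw [hm]; simp; omega)
      rw [hm0, ← mk_label_one e β (d := digit s) (by simp [hm])] at h2
      refine (edist_triangle _ _ _).trans ((add_le_add (Space.edist_mk_le _ _ _) h2).trans ?_)
      have hG : (0 : ℝ) ≤ G.len := G.len.2
      rw [← ENNReal.ofReal_add (by positivity) (mul_nonneg hG (by linarith))]
      refine ENNReal.ofReal_le_ofReal (le_of_eq ?_)
      have := le_digit_add_one s
      rw [coe_stretch, coe_diamond_len, Set.Icc.coe_one, abs_of_nonpos (by linarith)]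
      simp only [m]
      ring
  have aux : ∀ s t : unitInterval, s ≤ t → (digit t : ℕ) = digit s + (digit t - digit s : ℕ) :=
    fun s t h => by
      have : (digit s : ℕ) ≤ digit t := digit_mono h
      omega
  rcases le_total s t with h | h
  · have h' : (s : ℝ) ≤ t := h
    rw [abs_of_nonpos (by linarith), neg_sub]
    exact key _ s t h (aux s t h)
  · have h' : (t : ℝ) ≤ s := h
    rw [abs_of_nonneg (by linarith), edist_comm]
    exact key _ t s h (aux t s h)

theorem liftPoint_at {β : Bool} {p : G.Point} {v : G.V} (h : p.At v) :
    (liftPoint β p).At (.inl v) := by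
  rcases h with ⟨h, hv⟩ | ⟨h, hv⟩
  · refine .inl ⟨?_, ?_⟩
    · ext
      simp [liftPoint, h, digit]
    · simp [liftPoint, h, digit, label, diamond, hv, newEdge]
  · refine .inr ⟨?_, ?_⟩
    · ext
      simp [liftPoint, h, digit_one]
      norm_num
    · simp [liftPoint, h, digit_one, label, diamond, hv, newEdge]

theorem lipschitzWith_liftPoint (G : LenGraph) (β : Bool) :
    LipschitzWith 1 (liftPoint β : G.Point → G.diamond.Point) := by
  intro p q
  rw [ENNReal.coe_one, one_mul]
  refine le_iInf₂ fun L h => ?_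
  induction h with
  | refl p => simp
  | glue p q v hp hq =>
    exact (lengthDist_le (Joins.glue _ _ _ (liftPoint_at hp) (liftPoint_at hq))).trans (by simp)
  | segment e s t =>
    refine (edist_lift_le β e s t).trans (le_of_eq ?_)
    rw [ENNReal.ofReal_mul (NNReal.coe_nonneg _), ENNReal.coe_mul, ← Real.dist_eq,
      ← Subtype.dist_eq, dist_nndist]
    simp [edist_dist]
  | trans _ _ h1 h2 =>
    rw [ENNReal.coe_add]
    exact (edist_triangle _ _ _).trans (add_le_add h1 h2)

/-- The section of the collapsing map that runs through the top branch (`β = true`) or the bottom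
branch (`β = false`) of every diamond. -/
noncomputable def lift (β : Bool) : G.Space → G.diamond.Space :=
  SeparationQuotient.lift (fun p => SeparationQuotient.mk (liftPoint β p)) fun _ _ h =>
    SeparationQuotient.mk_eq_mk.2 (h.map (G.lipschitzWith_liftPoint β).continuous)

theorem lift_mk (β : Bool) (e : G.E) (s : unitInterval) :
    lift β (Space.mk G e s) = Space.mk G.diamond (newEdge e (label (digit s) β)) (stretch s) := rfl

theorem collapse_mk (e : G.E) (i : Fin 6) (s : unitInterval) :
    G.collapse (Space.mk G.diamond (newEdge e i) s) = Space.mk G e (quarterPos i s) := rfl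

theorem edist_lift_lift_le (β : Bool) (z z' : G.Space) :
    edist (lift β z) (lift β z') ≤ edist z z' := by
  obtain ⟨p, rfl⟩ := SeparationQuotient.surjective_mk z
  obtain ⟨q, rfl⟩ := SeparationQuotient.surjective_mk z'
  simpa [lift] using G.lipschitzWith_liftPoint β p q

theorem edist_collapse_le (z z' : G.diamond.Space) :
    edist (G.collapse z) (G.collapse z') ≤ edist z z' := by
  obtain ⟨p, rfl⟩ := SeparationQuotient.surjective_mk z
  obtain ⟨q, rfl⟩ := SeparationQuotient.surjective_mk z'
  simpa [collapse] using G.lipschitzWith_collapsePoint p q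

theorem quarterPos_stretch (s : unitInterval) (β : Bool) :
    quarterPos (label (digit s) β) (stretch s) = s := by
  ext
  simp [quarterPos]

theorem collapse_lift (β : Bool) (z : G.Space) : G.collapse (lift β z) = z := by
  obtain ⟨e, s, rfl⟩ := Space.exists_mk z
  rw [lift_mk, collapse_mk, quarterPos_stretch]

theorem exists_lift_collapse (z : G.diamond.Space) : ∃ β, lift β (G.collapse z) = z := by
  obtain ⟨a, s, rfl⟩ := Space.exists_mk z
  obtain ⟨e, i, rfl⟩ := exists_newEdge a
  obtain ⟨d, β, rfl⟩ := exists_label i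
  refine ⟨β, ?_⟩
  rw [collapse_mk, lift_mk]
  have hv : 4 * (quarterPos (label d β) s : ℝ) = (d : ℕ) + s := by
    simp [quarterPos]
    ring
  have h0 := s.2.1
  have h1 := s.2.2
  by_cases hs : (s : ℝ) < 1
  · have hd : digit (quarterPos (label d β) s) = d := digit_eq (by linarith) (by linarith)
    rw [hd]
    congr 1
    ext
    rw [coe_stretch, hv, hd]
    ring
  · -- The upper end of a quarter is the lower end of the next one, except at the top.
    obtain rfl : s = 1 := Subtype.ext (by rw [Set.Icc.coe_one]; linarith)
    have hd4 := d.2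
    by_cases h3 : d = 3
    · subst h3
      have : quarterPos (label 3 β) 1 = 1 := by
        ext
        simp at hv
        rw [Set.Icc.coe_one]
        linarith
      rw [this, digit_one]
      congr 1
      ext
      simp [digit_one]
      norm_num
    · have hd3 : (d : ℕ) + 1 < 4 := by
        have : (d : ℕ) ≠ 3 := fun h => h3 (Fin.ext h)
        omega
      have hd : digit (quarterPos (label d β) 1) = ⟨d + 1, hd3⟩ := by
        apply digit_eq <;> rw [hv] <;> simp
      rw [mk_label_one e β (d := d) (d' := ⟨d + 1, hd3⟩) rfl, hd]
      congr 1
      ext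
      rw [coe_stretch, hv, hd]
      simp

/-- The two branches of a diamond meet outside its two middle quarters. -/
theorem lift_eq_lift (e : G.E) {s : unitInterval} (hs : (s : ℝ) ∉ Set.Ioo (1 / 4 : ℝ) (3 / 4))
    (β β' : Bool) : lift β (Space.mk G e s) = lift β' (Space.mk G e s) := by
  rw [lift_mk, lift_mk]
  by_cases h : digit s = 0 ∨ digit s = 3
  · rw [label_congr h β β']
  · have hs4 : (s : ℝ) = 1 / 4 := by
      by_contra hne
      apply h
      unfold digit
      rcases lt_or_gt_of_ne hne with h' | h'
      · simp only [h', if_true, true_or]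
      · right
        have : 3 / 4 ≤ (s : ℝ) := by
          by_contra h''
          exact hs ⟨h', by linarith⟩
        rw [if_neg (by linarith), if_neg (by linarith), if_neg (by linarith)]
    have hd : digit s = 1 := by
      unfold digit
      rw [hs4]
      norm_num
    have hst : stretch s = 0 := by
      ext
      rw [coe_stretch, hd, hs4]
      norm_num
    rw [hst, hd, ← mk_label_one e β (d := 0) rfl, ← mk_label_one e β' (d := 0) rfl,
      label_congr (.inl rfl) β β']

end LenGraph

/-! ### Lower bounds for the distance -/

namespace LenGraph

open Laakso

variable {G : LenGraph}

/-- A function on marked points that is determined at the vertices, and `1`-Lipschitz in the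
coordinate of each edge, bounds the distance from below. -/
theorem Joins.abs_sub_le {F : G.Point → ℝ} (f : G.V → ℝ) (hv : ∀ p v, p.At v → F p = f v)
    (he : ∀ e s t, |F ⟨e, s⟩ - F ⟨e, t⟩| ≤ |(s : ℝ) - t|) {p q : G.Point} {L : ℝ≥0}
    (h : G.Joins p q L) : G.len * |F p - F q| ≤ L := by
  induction h with
  | refl p => simp
  | glue p q v hp hq => simp [hv p v hp, hv q v hq]
  | segment e s t =>
    rw [NNReal.coe_mul, coe_nndist, Subtype.dist_eq, Real.dist_eq]
    exact mul_le_mul_of_nonneg_left (he e s t) G.len.2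
  | @trans p q r a b _ _ h1 h2 =>
    rw [NNReal.coe_add]
    refine le_trans ?_ (add_le_add h1 h2)
    rw [← mul_add]
    exact mul_le_mul_of_nonneg_left (_root_.abs_sub_le _ _ _) G.len.2

theorem ofReal_le_edist {F : G.Point → ℝ} (f : G.V → ℝ) (hv : ∀ p v, p.At v → F p = f v)
    (he : ∀ e s t, |F ⟨e, s⟩ - F ⟨e, t⟩| ≤ |(s : ℝ) - t|) (e e' : G.E) (s t : unitInterval) :
    ENNReal.ofReal (G.len * |F ⟨e, s⟩ - F ⟨e', t⟩|) ≤
      edist (Space.mk G e s) (Space.mk G e' t) := by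
  refine le_iInf₂ fun L h => ?_
  rw [← ENNReal.ofReal_coe_nnreal]
  exact ENNReal.ofReal_le_ofReal (h.abs_sub_le f hv he)

theorem edist_unitSegment (s t : unitInterval) :
    edist (Space.mk unitSegment () s) (Space.mk unitSegment () t) =
      ENNReal.ofReal |(s : ℝ) - t| := by
  refine le_antisymm ?_ ?_
  · simpa [unitSegment] using Space.edist_mk_le (G := unitSegment) () s t
  · have := ofReal_le_edist (G := unitSegment) (F := fun p => (p.pos : ℝ))
      (fun v : Bool => cond v 1 0) ?_ (fun _ _ _ => le_rfl) () () s t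
    · simpa [unitSegment] using this
    · rintro p v (⟨h, hv⟩ | ⟨h, hv⟩) <;> subst hv <;> simp [h, unitSegment]

/-- The distance, in units of the length of the new edges, to the point at distance `v` from the
start on the bottom branch of the cycle in a diamond with edges `i = 1, 2, 3, 4`; on the end edges
`0` and `5` it is interpolated to the constant `1` outside the diamond. -/
noncomputable def diamondDist (v : ℝ) (i : Fin 6) (s : ℝ) : ℝ :=
  (![1 + (v - 1) * s, min (s + v) (4 - s - v), min (1 + s + v) (3 - s - v), |s - v|, |1 + s - v|,
    2 - v + (v - 1) * s] : Fin 6 → ℝ) i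

theorem abs_diamondDist_sub_le {v : ℝ} (h0 : 0 ≤ v) (h2 : v ≤ 2) (i : Fin 6) (s t : ℝ) :
    |diamondDist v i s - diamondDist v i t| ≤ |s - t| := by
  have hv : |v - 1| ≤ 1 := abs_le.2 ⟨by linarith, by linarith⟩
  have key : ∀ a b c d x : ℝ, |a - c| ≤ x → |b - d| ≤ x → |min a b - min c d| ≤ x :=
    fun a b c d x h h' => (abs_min_sub_min_le_max a b c d).trans (max_le h h')
  fin_cases i <;> simp only [diamondDist, Fin.zero_eta, Fin.mk_one, Fin.reduceFinMk,
    Matrix.cons_val]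
  · rw [show 1 + (v - 1) * s - (1 + (v - 1) * t) = (v - 1) * (s - t) by ring, abs_mul]
    exact mul_le_of_le_one_left (abs_nonneg _) hv
  · refine key _ _ _ _ _ (le_of_eq ?_) (le_of_eq ?_)
    · ring_nf
    · rw [abs_sub_comm]
      ring_nf
  · refine key _ _ _ _ _ (le_of_eq ?_) (le_of_eq ?_)
    · ring_nf
    · rw [abs_sub_comm]
      ring_nf
  · refine (abs_abs_sub_abs_le_abs_sub _ _).trans (le_of_eq ?_)
    ring_nf
  · refine (abs_abs_sub_abs_le_abs_sub _ _).trans (le_of_eq ?_)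
    ring_nf
  · rw [show 2 - v + (v - 1) * s - (2 - v + (v - 1) * t) = (v - 1) * (s - t) by ring, abs_mul]
    exact mul_le_of_le_one_left (abs_nonneg _) hv

open Classical in
/-- Two points on different branches of a diamond are at least as far from each other as in the
cycle formed by the two branches. -/
theorem le_edist_lift (e : G.E) {s s' : unitInterval} (hs : (s : ℝ) ∈ Set.Icc (1 / 4 : ℝ) (3 / 4))
    (hs' : (s' : ℝ) ∈ Set.Icc (1 / 4 : ℝ) (3 / 4)) :
    ENNReal.ofReal (G.len * min ((s : ℝ) + s' - 1 / 2) (3 / 2 - s - s')) ≤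
      edist (lift true (Space.mk G e s)) (lift false (Space.mk G e s')) := by
  set v : ℝ := 4 * s' - 1 with hv
  have h0 : 0 ≤ v := by linarith [hs'.1]
  have h2 : v ≤ 2 := by linarith [hs'.2]
  -- The distance to the second point in the cycle, extended to a `1`-Lipschitz function.
  let F : G.diamond.Point → ℝ := fun p =>
    if p.edge.1 = e then diamondDist v p.edge.2 p.pos else 1
  let f : G.diamond.V → ℝ := Sum.elim (fun _ => 1) fun a =>
    if a.1 = e then (![v, min (1 + v) (3 - v), |1 - v|, 2 - v] : Fin 4 → ℝ) a.2 else 1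
  have hF : ∀ p x, p.At x → F p = f x := by
    rintro ⟨⟨e', i⟩, t⟩ x (⟨ht, hx⟩ | ⟨ht, hx⟩) <;> dsimp only at ht hx <;> subst ht <;>
      subst hx <;> by_cases he : e' = e <;> fin_cases i <;>
      simp [F, f, he, diamond, diamondDist] <;>
      first
        | linarith
        | (rw [min_eq_right] <;> linarith)
        | (rw [abs_of_nonneg] <;> linarith)
        | (congr 1; ring)
  have hFe : ∀ a (s t : unitInterval), |F ⟨a, s⟩ - F ⟨a, t⟩| ≤ |(s : ℝ) - t| := by
    intro a s t
    by_cases he : a.1 = e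
    · simpa [F, he] using abs_diamondDist_sub_le h0 h2 a.2 s t
    · simp [F, he]
  have hd : ∀ t : unitInterval, (t : ℝ) ∈ Set.Icc (1 / 4 : ℝ) (3 / 4) →
      digit t = 1 ∨ digit t = 2 ∨ (digit t = 3 ∧ (t : ℝ) = 3 / 4) := by
    intro t ht
    unfold digit
    rw [if_neg (by linarith [ht.1])]
    split_ifs with h h'
    · exact .inl rfl
    · exact .inr (.inl rfl)
    · exact .inr (.inr ⟨rfl, by linarith [ht.2]⟩)
  have h1 : F (liftPoint false ⟨e, s'⟩) = 0 := by
    rcases hd s' hs' with h | h | ⟨h, h34⟩ <;>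
      simp [F, liftPoint, newEdge, h, label, diamondDist, hv]
    · linarith
    · rw [h34]
      norm_num
  have h2 : F (liftPoint true ⟨e, s⟩) = 4 * min ((s : ℝ) + s' - 1 / 2) (3 / 2 - s - s') := by
    rw [mul_min_of_nonneg _ _ (by norm_num : (0 : ℝ) ≤ 4)]
    rcases hd s hs with h | h | ⟨h, h34⟩ <;>
      simp [F, liftPoint, newEdge, h, label, diamondDist, hv]
    · congr 1 <;> ring
    · congr 1 <;> ring
    · rw [h34, min_eq_right (by linarith [hs'.1])]
      ring
  refine le_trans (ENNReal.ofReal_le_ofReal ?_) (ofReal_le_edist f hF hFe _ _ _ _)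
  change _ ≤ (G.diamond.len : ℝ) * |F (liftPoint true ⟨e, s⟩) - F (liftPoint false ⟨e, s'⟩)|
  rw [h1, h2, sub_zero, coe_diamond_len]
  refine le_trans (le_of_eq ?_) (mul_le_mul_of_nonneg_left (le_abs_self _)
    (div_nonneg G.len.2 (by norm_num)))
  ring

/-- Two points on different branches of a diamond are at least as far from each other as in the
cycle formed by the two branches. -/
theorem le_edist_lift_of_ne (e : G.E) {s s' : unitInterval}
    (hs : (s : ℝ) ∈ Set.Icc (1 / 4 : ℝ) (3 / 4)) (hs' : (s' : ℝ) ∈ Set.Icc (1 / 4 : ℝ) (3 / 4))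
    {β β' : Bool} (h : β ≠ β') :
    ENNReal.ofReal (G.len * min ((s : ℝ) + s' - 1 / 2) (3 / 2 - s - s')) ≤
      edist (lift β (Space.mk G e s)) (lift β' (Space.mk G e s')) := by
  cases β <;> cases β' <;> simp only [ne_eq, not_true_eq_false] at h
  · rw [edist_comm]
    convert le_edist_lift e hs' hs using 4 <;> ring
  · exact le_edist_lift e hs hs'

end LenGraph

/-! ### Heights and choices of branches as parameters -/

namespace Laakso

open LenGraph

/-- The coordinate of the height `t` in the edges of the `n`-th graph at that height. -/
noncomputable def posAt : ℕ → unitInterval → unitInterval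
  | 0, t => t
  | n + 1, t => stretch (posAt n t)

/-- The edge of the `n`-th graph at height `t` that is reached when the branch of each diamond of
generation `k` is chosen according to `b k`. At a vertex height it is the edge above the vertex,
except at the upper end of the unit interval. -/
noncomputable def edgeAt (b : ℕ → Bool) (t : unitInterval) : ∀ n, (graph n).E
  | 0 => ()
  | n + 1 => newEdge (edgeAt b t n) (label (digit (posAt n t)) (b n))

/-- The point of the `n`-th graph at height `t` that is reached when the branch of each diamond of
generation `k` is chosen according to `b k`. -/
noncomputable def param (n : ℕ) (t : unitInterval) (b : ℕ → Bool) : (graph n).Space :=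
  Space.mk (graph n) (edgeAt b t n) (posAt n t)

theorem param_succ (n : ℕ) (t : unitInterval) (b : ℕ → Bool) :
    param (n + 1) t b = lift (b n) (param n t b) := rfl

theorem proj_param (n : ℕ) (t : unitInterval) (b : ℕ → Bool) :
    proj n (param (n + 1) t b) = param n t b := by
  rw [param_succ]
  exact collapse_lift _ _

theorem coe_graph_len (n : ℕ) : ((graph n).len : ℝ) = 1 / 4 ^ n := by
  induction n with
  | zero => simp [graph, unitSegment]
  | succ n ih =>
    rw [graph, coe_diamond_len, ih, pow_succ]
    ring

theorem edist_param_le (n : ℕ) (s t : unitInterval) (b : ℕ → Bool) :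
    edist (param n s b) (param n t b) ≤ ENNReal.ofReal |(s : ℝ) - t| := by
  induction n with
  | zero => exact (edist_unitSegment s t).le
  | succ n ih =>
    rw [param_succ, param_succ]
    exact (edist_lift_lift_le _ _ _).trans ih

theorem le_edist_param (n : ℕ) (s t : unitInterval) (b c : ℕ → Bool) :
    ENNReal.ofReal |(s : ℝ) - t| ≤ edist (param n s b) (param n t c) := by
  induction n with
  | zero => exact (edist_unitSegment s t).ge
  | succ n ih =>
    refine ih.trans ?_
    rw [← proj_param n s b, ← proj_param n t c]
    exact edist_collapse_le _ _

/-! ### Heights -/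

/-- The height `t` lies strictly between the ends of the two branches of a diamond of
generation `k`. -/
def Mid (k : ℕ) (t : unitInterval) : Prop := (posAt k t : ℝ) ∈ Set.Ioo (1 / 4 : ℝ) (3 / 4)

/-- The coordinate of `t` in generation `n` is the fractional part of `4 ^ n * t`, except that it
is `1` instead of `0` at the upper end of the unit interval. -/
theorem exists_pow_mul_eq (n : ℕ) (t : unitInterval) :
    ∃ m : ℤ, 4 ^ n * (t : ℝ) = m + posAt n t := by
  induction n with
  | zero => exact ⟨0, by simp [posAt]⟩
  | succ n ih =>
    obtain ⟨m, hm⟩ := ih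
    refine ⟨4 * m + (digit (posAt n t) : ℕ), ?_⟩
    rw [posAt, coe_stretch, pow_succ, mul_right_comm, hm]
    push_cast
    ring

theorem mid_iff {k : ℕ} {t : unitInterval} :
    Mid k t ↔ ∃ m : ℤ, (m : ℝ) + 1 / 4 < 4 ^ k * t ∧ 4 ^ k * (t : ℝ) < m + 3 / 4 := by
  obtain ⟨m, hm⟩ := exists_pow_mul_eq k t
  rw [hm]
  constructor
  · rintro ⟨h0, h1⟩
    exact ⟨m, by linarith, by linarith⟩
  · rintro ⟨m', h0, h1⟩
    have p0 := (posAt k t).2.1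
    have p1 := (posAt k t).2.2
    have hmm : m = m' := by
      have e1 : m < m' + 1 := by
        have : (m : ℝ) < m' + 1 := by linarith
        exact_mod_cast this
      have e2 : m' < m + 1 := by
        have : (m' : ℝ) < m + 1 := by linarith
        exact_mod_cast this
      omega
    subst hmm
    exact ⟨by linarith, by linarith⟩

/-- The coordinate is affine on each cell of generation `k`, excluding its upper end. -/
theorem posAt_eq_of_mem {k : ℕ} {t x : unitInterval}
    (h : (posAt k t : ℝ) + 4 ^ k * (x - t) ∈ Set.Ico (0 : ℝ) 1) :
    (posAt k x : ℝ) = posAt k t + 4 ^ k * (x - t) ∧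
      ∀ j < k, digit (posAt j x) = digit (posAt j t) := by
  induction k with
  | zero => simp [posAt]
  | succ k ih =>
    rw [posAt, coe_stretch, pow_succ] at h
    have hd : ((digit (posAt k t) : ℕ) : ℝ) ≤ 3 := by
      exact_mod_cast Nat.le_of_lt_succ (digit (posAt k t)).2
    have hd0 : (0 : ℝ) ≤ (digit (posAt k t) : ℕ) := Nat.cast_nonneg _
    obtain ⟨h1, h2⟩ := ih ⟨by linarith [h.1], by linarith [h.2]⟩
    have h3 : digit (posAt k x) = digit (posAt k t) := by
      apply digit_eq <;> rw [h1]
      · linarith [h.1]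
      · linarith [h.2]
    refine ⟨?_, fun j hj => ?_⟩
    · rw [posAt, posAt, coe_stretch, coe_stretch, h3, h1, pow_succ]
      ring
    · rcases Nat.lt_succ_iff_lt_or_eq.1 hj with hj | rfl
      exacts [h2 j hj, h3]

/-- The cell of generation `k` that contains `t` has points with any coordinate `ρ`. -/
theorem exists_shift (k : ℕ) (t : unitInterval) {ρ : ℝ} (hρ : ρ ∈ Set.Icc (0 : ℝ) 1) :
    ∃ x : unitInterval, (x : ℝ) = t + (ρ - posAt k t) / 4 ^ k := by
  induction k generalizing ρ with
  | zero => exact ⟨⟨ρ, hρ⟩, by simp [posAt]⟩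
  | succ k ih =>
    have hd : ((digit (posAt k t) : ℕ) : ℝ) ≤ 3 := by
      exact_mod_cast Nat.le_of_lt_succ (digit (posAt k t)).2
    have hd0 : (0 : ℝ) ≤ (digit (posAt k t) : ℕ) := Nat.cast_nonneg _
    obtain ⟨x, hx⟩ := ih (ρ := (ρ + (digit (posAt k t) : ℕ)) / 4)
      ⟨by linarith [hρ.1], by linarith [hρ.2]⟩
    refine ⟨x, hx.trans ?_⟩
    rw [posAt, coe_stretch, pow_succ]
    field_simp
    ring

theorem posAt_eq_zero_of_le {k : ℕ} {t : unitInterval} (h : posAt k t = 0) {j : ℕ} (hj : k ≤ j) :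
    posAt j t = 0 := by
  induction j, hj using Nat.le_induction with
  | base => exact h
  | succ j _ ih =>
    ext
    rw [posAt, coe_stretch, ih]
    simp [digit]

theorem not_mid_of_posAt_eq_zero {k : ℕ} {t : unitInterval} (h : posAt k t = 0) {j : ℕ}
    (hj : k ≤ j) : ¬ Mid j t := by
  rw [Mid, posAt_eq_zero_of_le h hj]
  norm_num

/-- `v` is the height of vertices of the `n`-th graph. -/
def IsGrid (n : ℕ) (v : unitInterval) : Prop := ∃ N : ℤ, 4 ^ n * (v : ℝ) = N

theorem exists_isGrid (n : ℕ) (t : unitInterval) :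
    ∃ v, IsGrid n v ∧ |(t : ℝ) - v| ≤ 1 / 4 ^ n / 2 := by
  obtain ⟨m, hm⟩ := exists_pow_mul_eq n t
  have hpow : (0 : ℝ) < 4 ^ n := by positivity
  have p0 := (posAt n t).2.1
  have p1 := (posAt n t).2.2
  -- Choose the nearer one of the two ends of the edges at height `t`.
  have key : ∀ e : ℤ, ((e : ℝ) ∈ Set.Icc (0 : ℝ) 1) → |(e : ℝ) - posAt n t| ≤ 1 / 2 →
      ∃ v, IsGrid n v ∧ |(t : ℝ) - v| ≤ 1 / 4 ^ n / 2 := by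
    intro e he hd
    obtain ⟨x, hx⟩ := exists_shift n t he
    refine ⟨x, ⟨m + e, ?_⟩, ?_⟩
    · rw [hx, mul_add, hm]
      push_cast
      field_simp
      ring
    · rw [hx, sub_add_cancel_left, abs_neg, abs_div, abs_of_pos hpow, div_div, mul_comm, ← div_div,
        div_le_div_iff_of_pos_right hpow]
      exact hd
  by_cases h : (posAt n t : ℝ) ≤ 1 / 2
  · refine key 0 (by simp) ?_
    rw [Int.cast_zero, zero_sub, abs_neg, abs_of_nonneg p0]
    exact h
  · refine key 1 (by simp) ?_
    rw [Int.cast_one, abs_of_nonneg (by linarith)]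
    linarith

theorem IsGrid.not_mid {n k : ℕ} {v : unitInterval} (hv : IsGrid n v) (h : n ≤ k) : ¬ Mid k v := by
  obtain ⟨N, hN⟩ := hv
  obtain ⟨j, rfl⟩ := Nat.exists_eq_add_of_le h
  rw [mid_iff]
  rintro ⟨m, h0, h1⟩
  rw [pow_add, mul_right_comm, hN] at h0 h1
  have e0 : m < N * 4 ^ j := by
    have : (m : ℝ) < ((N * 4 ^ j : ℤ) : ℝ) := by push_cast; linarith
    exact_mod_cast this
  have e1 : N * 4 ^ j < m + 1 := by
    have : ((N * 4 ^ j : ℤ) : ℝ) < m + 1 := by push_cast; linarith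
    exact_mod_cast this
  omega

/-- An interval between the ends of the branches of a diamond of generation `k` that contains a
vertex height `v` of generation `n` also contains the two adjacent cells of generation `n`. -/
theorem IsGrid.mid_of_mid {n k : ℕ} {v τ : unitInterval} (hv : IsGrid n v) (h : Mid k v)
    (hτ : |(τ : ℝ) - v| < 1 / 4 ^ n) : Mid k τ := by
  have hkn : k < n := by
    by_contra hkn
    exact hv.not_mid (by omega) h
  obtain ⟨N, hN⟩ := hv
  obtain ⟨j, rfl⟩ := Nat.exists_eq_add_of_lt hkn
  obtain ⟨m, h0, h1⟩ := mid_iff.1 h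
  have hj : (0 : ℝ) < 4 ^ j := by positivity
  have hk : (0 : ℝ) < 4 ^ k := by positivity
  rw [pow_succ, pow_add] at hN hτ
  have e0 : 4 ^ j * (4 * m + 1) + 1 ≤ N := by
    have : ((4 ^ j * (4 * m + 1) : ℤ) : ℝ) < N := by
      push_cast
      rw [← hN]
      have := mul_lt_mul_of_pos_left h0 hj
      linarith
    have : 4 ^ j * (4 * m + 1) < N := by exact_mod_cast this
    omega
  have e1 : N + 1 ≤ 4 ^ j * (4 * m + 3) := by
    have : (N : ℝ) < ((4 ^ j * (4 * m + 3) : ℤ) : ℝ) := by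
      push_cast
      rw [← hN]
      have := mul_lt_mul_of_pos_left h1 hj
      linarith
    have : N < 4 ^ j * (4 * m + 3) := by exact_mod_cast this
    omega
  have e0' : (4 : ℝ) ^ j * (4 * m + 1) + 1 ≤ N := by exact_mod_cast e0
  have e1' : (N : ℝ) + 1 ≤ 4 ^ j * (4 * m + 3) := by exact_mod_cast e1
  rw [lt_div_iff₀ (by positivity), ← abs_of_pos (by positivity : (0 : ℝ) < 4 ^ k * 4 ^ j * 4),
    ← abs_mul, abs_lt] at hτ
  refine mid_iff.2 ⟨m, ?_, ?_⟩
  · refine lt_of_mul_lt_mul_left ?_ (by positivity : (0 : ℝ) ≤ 4 ^ j * 4)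
    linarith [hτ.1]
  · refine lt_of_mul_lt_mul_left ?_ (by positivity : (0 : ℝ) ≤ 4 ^ j * 4)
    linarith [hτ.2]

/-! ### When two choices of branches lead to the same point -/

/-- At height `τ` the choices `b` and `c` of branches lead to the same point. -/
def Agree (τ : unitInterval) (b c : ℕ → Bool) : Prop := ∀ k, b k = c k ∨ ¬ Mid k τ

theorem Agree.param_eq {τ : unitInterval} {b c : ℕ → Bool} (h : Agree τ b c) (n : ℕ) :
    param n τ b = param n τ c := by
  induction n with
  | zero => rfl
  | succ n ih =>
    rw [param_succ, param_succ, ih]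
    rcases h n with h | h
    · rw [h]
    · exact lift_eq_lift _ h _ _

theorem IsGrid.agree {n : ℕ} {v τ : unitInterval} {b c : ℕ → Bool} (hv : IsGrid n v)
    (h : Agree τ b c) (hτ : |(τ : ℝ) - v| < 1 / 4 ^ n) : Agree v b c :=
  fun k => (h k).imp_right fun hk hm => hk (hv.mid_of_mid hm hτ)

theorem edgeAt_congr {k : ℕ} {s t : unitInterval} {b c : ℕ → Bool}
    (hd : ∀ j < k, digit (posAt j s) = digit (posAt j t))
    (hb : ∀ j < k, b j = c j ∨ digit (posAt j t) = 0 ∨ digit (posAt j t) = 3) :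
    edgeAt b s k = edgeAt c t k := by
  induction k with
  | zero => rfl
  | succ k ih =>
    rw [edgeAt, edgeAt, ih (fun j hj => hd j (by omega)) (fun j hj => hb j (by omega)),
      hd k (by omega)]
    rcases hb k (by omega) with h | h
    · rw [h]
    · rw [label_congr h (b k) (c k)]

/-- Let `k` be a generation in which `s` is strictly between the ends of the branches of a diamond,
and let no earlier generation separate the choices `b` and `c` at height `s`. Then the earlier
edges at height `s` are the same for `b` and `c`, and `b` and `c` agree at the two ends `x` of these
branches. -/
theorem agree_of_posAt {k : ℕ} {s x : unitInterval} {b c : ℕ → Bool} (hs : Mid k s)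
    (hmin : ∀ j < k, b j = c j ∨ ¬ Mid j s) (hx : (posAt k x : ℝ) = 1 / 4 ∨ (posAt k x : ℝ) = 3 / 4)
    (hd : ∀ j < k, digit (posAt j x) = digit (posAt j s)) :
    (∀ j < k, b j = c j ∨ digit (posAt j s) = 0 ∨ digit (posAt j s) = 3) ∧ Agree x b c := by
  have key : ∀ j < k, b j = c j ∨ digit (posAt j s) = 0 ∨ digit (posAt j s) = 3 := by
    intro j hj
    refine (hmin j hj).imp_right fun hm => ?_
    by_contra hcon
    push Not at hcon
    have h4 : (posAt j s : ℝ) = 1 / 4 := by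
      by_contra hne
      have h0 := digit_le (posAt j s)
      have h1 := le_digit_add_one (posAt j s)
      have h2 : digit (posAt j s) = 1 ∨ digit (posAt j s) = 2 := by
        generalize digit (posAt j s) = d at hcon
        fin_cases d <;> simp at hcon ⊢
      refine hm ⟨lt_of_le_of_ne ?_ (Ne.symm hne), lt_of_le_of_ne ?_ fun h34 => ?_⟩
      · rcases h2 with h | h <;> rw [h] at h0 <;> norm_num at h0 <;> linarith
      · rcases h2 with h | h <;> rw [h] at h1 <;> norm_num at h1 <;> linarith
      · apply hcon.2
        unfold digit
        rw [h34]
        norm_num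
    refine not_mid_of_posAt_eq_zero (k := j + 1) ?_ hj hs
    ext
    rw [posAt, coe_stretch, h4]
    have : digit (posAt j s) = 1 := by
      unfold digit
      rw [h4]
      norm_num
    rw [this]
    norm_num
  refine ⟨key, fun j => ?_⟩
  -- In later generations `x` is a vertex height.
  rcases lt_trichotomy j k with hj | rfl | hj
  · refine (key j hj).imp_right fun h hm => ?_
    rw [← hd j hj] at h
    have h0 := digit_le (posAt j x)
    have h1 := le_digit_add_one (posAt j x)
    rcases h with h | h <;> rw [h] at h0 h1 <;> norm_num at h0 h1
    · linarith [hm.1]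
    · linarith [hm.2]
  · right
    rintro ⟨h0, h1⟩
    rcases hx with h | h <;> rw [h] at h0 h1 <;> linarith
  · right
    refine not_mid_of_posAt_eq_zero (k := k + 1) ?_ hj
    ext
    rw [posAt, coe_stretch]
    rcases hx with h | h <;> unfold digit <;> rw [h] <;> norm_num

/-- The shortest path between two points passes through a height where the two choices of branches
agree, and it is monotone before and after. -/
theorem exists_agree_le_edist_param (s t : unitInterval) (b c : ℕ → Bool) :
    ∃ τ : unitInterval, Agree τ b c ∧ ∃ n,
      ENNReal.ofReal (|(s : ℝ) - τ| + |(τ : ℝ) - t|) ≤ edist (param n s b) (param n t c) := by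
  -- If the choices agree at some height between `s` and `t`, then the distance of the heights is
  -- a sufficient lower bound.
  by_cases hcase : ∃ τ ∈ Set.uIcc (s : ℝ) t, ∃ τ' : unitInterval, (τ' : ℝ) = τ ∧ Agree τ' b c
  · obtain ⟨_, hτ, τ, rfl, hag⟩ := hcase
    refine ⟨τ, hag, 0, le_trans (ENNReal.ofReal_le_ofReal (le_of_eq ?_)) (le_edist_param 0 s t b c)⟩
    rcases le_total (s : ℝ) t with h | h
    · rw [Set.uIcc_of_le h] at hτ
      rw [abs_of_nonpos (by linarith [hτ.1]), abs_of_nonpos (by linarith [hτ.2]),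
        abs_of_nonpos (by linarith)]
      ring
    · rw [Set.uIcc_of_ge h] at hτ
      rw [abs_of_nonneg (by linarith [hτ.2]), abs_of_nonneg (by linarith [hτ.1]),
        abs_of_nonneg (by linarith)]
      ring
  push Not at hcase
  -- Otherwise the two points are on different branches of a diamond of some generation `k`.
  have hs : ∃ k, ¬ (b k = c k ∨ ¬ Mid k s) := by
    have := hcase s Set.left_mem_uIcc s rfl
    simpa only [Agree, not_forall] using this
  classical
  obtain ⟨k, hk, hmin⟩ : ∃ k, ¬ (b k = c k ∨ ¬ Mid k s) ∧ ∀ j < k, b j = c j ∨ ¬ Mid j s :=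
    ⟨Nat.find hs, Nat.find_spec hs, fun j hj => not_not.1 (Nat.find_min hs hj)⟩
  push Not at hk
  obtain ⟨hbc, hmid⟩ := hk
  have hpow : (0 : ℝ) < 4 ^ k := by positivity
  obtain ⟨p, hp⟩ := exists_shift k s (ρ := 1 / 4) (by norm_num)
  obtain ⟨q, hq⟩ := exists_shift k s (ρ := 3 / 4) (by norm_num)
  have hp' : (posAt k s : ℝ) + 4 ^ k * (p - s) = 1 / 4 := by
    rw [hp]
    field_simp
    ring
  have hq' : (posAt k s : ℝ) + 4 ^ k * (q - s) = 3 / 4 := by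
    rw [hq]
    field_simp
    ring
  obtain ⟨hp1, hp2⟩ := posAt_eq_of_mem (k := k) (t := s) (x := p) (by rw [hp']; norm_num)
  obtain ⟨hq1, hq2⟩ := posAt_eq_of_mem (k := k) (t := s) (x := q) (by rw [hq']; norm_num)
  obtain ⟨hdig, hpa⟩ := agree_of_posAt hmid hmin (.inl (hp1.trans hp')) hp2
  obtain ⟨-, hqa⟩ := agree_of_posAt hmid hmin (.inr (hq1.trans hq')) hq2
  have hps : (p : ℝ) < s := by
    rw [hp, add_lt_iff_neg_left]
    exact div_neg_of_neg_of_pos (by linarith [hmid.1]) hpow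
  have hsq : (s : ℝ) < q := by
    rw [hq, lt_add_iff_pos_right]
    exact div_pos (by linarith [hmid.2]) hpow
  have hpt : (p : ℝ) < t := by
    by_contra h
    exact hcase p (by rw [Set.uIcc_of_ge (by linarith)]; exact ⟨by linarith, hps.le⟩) p rfl hpa
  have htq : (t : ℝ) < q := by
    by_contra h
    exact hcase q (by rw [Set.uIcc_of_le (by linarith)]; exact ⟨hsq.le, by linarith⟩) q rfl hqa
  have hpt' := mul_lt_mul_of_pos_left hpt hpow
  have htq' := mul_lt_mul_of_pos_left htq hpow
  obtain ⟨ht1, ht2⟩ := posAt_eq_of_mem (k := k) (t := s) (x := t) ⟨by linarith, by linarith⟩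
  have hedge : edgeAt c t k = edgeAt b s k :=
    edgeAt_congr ht2 fun j hj => (hdig j hj).imp_left Eq.symm
  have hlow := le_edist_lift_of_ne (edgeAt b s k) (s := posAt k s) (s' := posAt k t)
    ⟨hmid.1.le, hmid.2.le⟩ ⟨by linarith, by linarith⟩ hbc
  have hlow' : ENNReal.ofReal (1 / 4 ^ k *
      min ((posAt k s : ℝ) + posAt k t - 1 / 2) (3 / 2 - posAt k s - posAt k t)) ≤
      edist (param (k + 1) s b) (param (k + 1) t c) := by
    rw [← coe_graph_len, param_succ, param_succ, param, param, hedge]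
    exact hlow
  rcases le_total ((posAt k s : ℝ) + posAt k t - 1 / 2) (3 / 2 - posAt k s - posAt k t) with h | h
  · refine ⟨p, hpa, k + 1, le_trans (ENNReal.ofReal_le_ofReal (le_of_eq ?_)) hlow'⟩
    rw [min_eq_left h, abs_of_pos (by linarith), abs_of_neg (by linarith), ht1, one_div_mul_eq_div,
      eq_div_iff hpow.ne']
    linarith
  · refine ⟨q, hqa, k + 1, le_trans (ENNReal.ofReal_le_ofReal (le_of_eq ?_)) hlow'⟩
    rw [min_eq_right h, abs_of_neg (by linarith), abs_of_pos (by linarith), ht1, one_div_mul_eq_div,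
      eq_div_iff hpow.ne']
    linarith

end Laakso

namespace Laakso

open LenGraph

/-! ### The inverse limit -/

/-- The inverse limit of the diamond graphs, as the space of compatible sequences. -/
def Limit : Type := {z : ∀ n, (graph n).Space // ∀ n, proj n (z (n + 1)) = z n}

namespace Limit

/-- The projection of the inverse limit to the `n`-th graph. -/
def coord (n : ℕ) (x : Limit) : (graph n).Space := x.1 n

theorem proj_coord (n : ℕ) (x : Limit) : proj n (coord (n + 1) x) = coord n x := x.2 n

theorem ext_coord {x y : Limit} (h : ∀ n, coord n x = coord n y) : x = y :=
  Subtype.ext (funext h)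

/-- The point at height `t` that is reached when the branch of each diamond of generation `k` is
chosen according to `b k`. -/
noncomputable def point (t : unitInterval) (b : ℕ → Bool) : Limit :=
  ⟨fun n => param n t b, fun n => proj_param n t b⟩

theorem coord_point (n : ℕ) (t : unitInterval) (b : ℕ → Bool) :
    coord n (point t b) = param n t b := rfl

theorem exists_point (x : Limit) : ∃ t b, point t b = x := by
  have h : ∀ n, ∃ β, lift β (coord n x) = coord (n + 1) x := fun n => by
    rw [← proj_coord n x]
    exact exists_lift_collapse _
  choose b hb using h
  obtain ⟨e, t, ht⟩ := Space.exists_mk (coord 0 x)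
  refine ⟨t, b, ext_coord fun n => ?_⟩
  rw [coord_point]
  induction n with
  | zero => exact ht
  | succ n ih => rw [param_succ, ih, hb]

/-- The distances in the graphs are nondecreasing, so their limit is their supremum. -/
noncomputable instance : EDist Limit := ⟨fun x y => ⨆ n, edist (coord n x) (coord n y)⟩

theorem edist_def (x y : Limit) : edist x y = ⨆ n, edist (coord n x) (coord n y) := rfl

theorem edist_coord_le (n : ℕ) (x y : Limit) : edist (coord n x) (coord n y) ≤ edist x y :=
  le_iSup (fun n => edist (coord n x) (coord n y)) n

theorem edist_point_le (s t : unitInterval) (b : ℕ → Bool) :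
    edist (point s b) (point t b) ≤ ENNReal.ofReal |(s : ℝ) - t| :=
  iSup_le fun n => edist_param_le n s t b

theorem point_eq_point {τ : unitInterval} {b c : ℕ → Bool} (h : Agree τ b c) :
    point τ b = point τ c := ext_coord fun n => h.param_eq n

theorem agree_zero (b c : ℕ → Bool) : Agree 0 b c := fun _ =>
  .inr (not_mid_of_posAt_eq_zero (k := 0) rfl (Nat.zero_le _))

noncomputable instance : EMetricSpace Limit where
  edist_self x := by simp [edist_def]
  edist_comm x y := by simp [edist_def, edist_comm]
  edist_triangle x y z := iSup_le fun n => (edist_triangle _ (coord n y) _).trans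
    (add_le_add (edist_coord_le n x y) (edist_coord_le n y z))
  eq_of_edist_eq_zero {x y} h := ext_coord fun n =>
    edist_eq_zero.1 (le_antisymm ((edist_coord_le n x y).trans h.le) zero_le)

theorem edist_ne_top (x y : Limit) : edist x y ≠ ⊤ := by
  obtain ⟨t, b, rfl⟩ := exists_point x
  obtain ⟨s, c, rfl⟩ := exists_point y
  refine ne_top_of_le_ne_top ?_ (edist_triangle _ (point 0 b) _)
  refine ENNReal.add_ne_top.2 ⟨ne_top_of_le_ne_top ENNReal.ofReal_ne_top (edist_point_le t 0 b), ?_⟩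
  rw [point_eq_point (agree_zero b c)]
  exact ne_top_of_le_ne_top ENNReal.ofReal_ne_top (edist_point_le 0 s c)

noncomputable instance : MetricSpace Limit := EMetricSpace.toMetricSpace edist_ne_top

noncomputable instance : MeasurableSpace Limit := borel _

instance : BorelSpace Limit := ⟨rfl⟩

theorem isLimit : IsLimit Limit coord where
  compat := proj_coord
  existsUnique z hz := ⟨⟨z, hz⟩, fun _ => rfl, fun _ hy => ext_coord hy⟩
  tendsto_edist x y := by
    refine tendsto_atTop_iSup (monotone_nat_of_le_succ fun n => ?_)
    rw [← proj_coord n x, ← proj_coord n y]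
    exact edist_collapse_le _ _

theorem lipschitzWith_coord (n : ℕ) : LipschitzWith 1 (coord n) := fun x y => by
  rw [ENNReal.coe_one, one_mul]
  exact edist_coord_le n x y

theorem dist_eq_toReal (x y : Limit) : dist x y = (edist x y).toReal := rfl

theorem abs_sub_le_dist (s t : unitInterval) (b c : ℕ → Bool) :
    |(s : ℝ) - t| ≤ dist (point s b) (point t c) := by
  rw [dist_eq_toReal, ← ENNReal.ofReal_le_iff_le_toReal (edist_ne_top _ _)]
  exact (le_edist_param 0 s t b c).trans (edist_coord_le 0 _ _)

theorem dist_point (s t : unitInterval) (b : ℕ → Bool) :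
    dist (point s b) (point t b) = |(s : ℝ) - t| := by
  refine le_antisymm ?_ (abs_sub_le_dist s t b b)
  rw [dist_eq_toReal]
  exact ENNReal.toReal_le_of_le_ofReal (abs_nonneg _) (edist_point_le s t b)

theorem exists_agree_le_dist (s t : unitInterval) (b c : ℕ → Bool) :
    ∃ τ, Agree τ b c ∧ |(s : ℝ) - τ| + |(τ : ℝ) - t| ≤ dist (point s b) (point t c) := by
  obtain ⟨τ, hτ, n, hn⟩ := exists_agree_le_edist_param s t b c
  refine ⟨τ, hτ, ?_⟩
  rw [dist_eq_toReal, ← ENNReal.ofReal_le_iff_le_toReal (edist_ne_top _ _)]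
  exact hn.trans (edist_coord_le n _ _)

theorem dist_le_of_agree {τ : unitInterval} {b c : ℕ → Bool} (h : Agree τ b c)
    (s t : unitInterval) : dist (point s b) (point t c) ≤ |(s : ℝ) - τ| + |(τ : ℝ) - t| := by
  refine (dist_triangle _ (point τ b) _).trans (add_le_add (dist_point s τ b).le ?_)
  rw [point_eq_point h]
  exact (dist_point τ t c).le

theorem point_eq_point_iff {s t : unitInterval} {b c : ℕ → Bool} :
    point s b = point t c ↔ s = t ∧ Agree s b c := by
  refine ⟨fun h => ?_, fun ⟨h, h'⟩ => h ▸ point_eq_point h'⟩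
  obtain ⟨τ, hτ, hle⟩ := exists_agree_le_dist s t b c
  rw [h, dist_self] at hle
  have n1 := abs_nonneg ((s : ℝ) - τ)
  have n2 := abs_nonneg ((τ : ℝ) - t)
  have h1 : (s : ℝ) - τ = 0 := abs_eq_zero.1 (by linarith)
  have h2 : (τ : ℝ) - t = 0 := abs_eq_zero.1 (by linarith)
  obtain rfl : s = τ := Subtype.ext (by linarith)
  exact ⟨Subtype.ext (by linarith), hτ⟩

theorem continuous_point : Continuous fun p : unitInterval × (ℕ → Bool) => point p.1 p.2 := by
  rw [continuous_iff_continuousAt]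
  rintro ⟨t, b⟩
  rw [ContinuousAt, Metric.tendsto_nhds]
  intro ε hε
  obtain ⟨n, hn⟩ := exists_pow_lt_of_lt_one (half_pos hε) (by norm_num : (1 / 4 : ℝ) < 1)
  rw [div_pow, one_pow] at hn
  have h1 : ∀ᶠ p : unitInterval × (ℕ → Bool) in 𝓝 (t, b), dist p.1 t < ε / 2 :=
    (continuous_fst.dist continuous_const).continuousAt.eventually_lt continuousAt_const
      (by simpa using half_pos hε)
  have h2 : ∀ᶠ p : unitInterval × (ℕ → Bool) in 𝓝 (t, b), ∀ k < n, p.2 k = b k := by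
    refine (eventually_all_finite (Set.finite_lt_nat n)).2 fun k _ => ?_
    exact (((continuous_apply k).comp continuous_snd).continuousAt (x := (t, b))).eventually
      ((isOpen_discrete {b k}).mem_nhds rfl)
  filter_upwards [h1, h2] with p hp hp2
  -- Choices that agree up to generation `n` lead to the same vertex of generation `n` near `t`.
  obtain ⟨v, hv, hvt⟩ := exists_isGrid n t
  have hag : Agree v p.2 b := fun k => by
    rcases lt_or_ge k n with hk | hk
    exacts [.inl (hp2 k hk), .inr (hv.not_mid hk)]
  refine (dist_le_of_agree hag p.1 t).trans_lt ?_
  rw [Subtype.dist_eq, Real.dist_eq] at hp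
  have := abs_sub_le (p.1 : ℝ) t v
  rw [abs_sub_comm (v : ℝ)]
  linarith

instance : CompactSpace Limit := by
  have h : Set.range (fun p : unitInterval × (ℕ → Bool) => point p.1 p.2) = Set.univ :=
    Set.range_eq_univ.2 fun x => by
      obtain ⟨t, b, h⟩ := exists_point x
      exact ⟨(t, b), h⟩
  exact ⟨h ▸ isCompact_range continuous_point⟩

end Limit

/-! ### Geodesics -/

/-- The concatenation of two minimal geodesics whose lengths add up to the distance of the ends is
a minimal geodesic. -/
theorem exists_geodesic_trans {X : Type*} [MetricSpace X] {x y z : X}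
    (h : dist x y + dist y z ≤ dist x z)
    (h1 : ∃ γ : ℝ → X, γ 0 = x ∧ γ (dist x y) = y ∧
      ∀ s ∈ Set.Icc 0 (dist x y), ∀ t ∈ Set.Icc 0 (dist x y), dist (γ s) (γ t) = |s - t|)
    (h2 : ∃ γ : ℝ → X, γ 0 = y ∧ γ (dist y z) = z ∧
      ∀ s ∈ Set.Icc 0 (dist y z), ∀ t ∈ Set.Icc 0 (dist y z), dist (γ s) (γ t) = |s - t|) :
    ∃ γ : ℝ → X, γ 0 = x ∧ γ (dist x z) = z ∧
      ∀ s ∈ Set.Icc 0 (dist x z), ∀ t ∈ Set.Icc 0 (dist x z), dist (γ s) (γ t) = |s - t| := by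
  obtain ⟨γ, hγ0, hγ1, hγ⟩ := h1
  obtain ⟨δ, hδ0, hδ1, hδ⟩ := h2
  have hd : dist x z = dist x y + dist y z := le_antisymm (dist_triangle _ _ _) h
  have hxy := dist_nonneg (x := x) (y := y)
  have hyz := dist_nonneg (x := y) (y := z)
  let η : ℝ → X := fun s => if s ≤ dist x y then γ s else δ (s - dist x y)
  have key : ∀ s t, 0 ≤ s → s ≤ t → t ≤ dist x z → dist (η s) (η t) = t - s := by
    intro s t hs hst ht
    by_cases hs' : s ≤ dist x y <;> by_cases ht' : t ≤ dist x y
    · simp only [η, if_pos hs', if_pos ht']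
      rw [hγ s ⟨hs, hs'⟩ t ⟨by linarith, ht'⟩, abs_of_nonpos (by linarith)]
      ring
    · simp only [η, if_pos hs', if_neg ht']
      have e1 := hγ 0 ⟨le_rfl, hxy⟩ s ⟨hs, hs'⟩
      have e2 := hγ s ⟨hs, hs'⟩ (dist x y) ⟨hxy, le_rfl⟩
      have e3 := hδ 0 ⟨le_rfl, hyz⟩ (t - dist x y) ⟨by linarith, by linarith⟩
      have e4 := hδ (t - dist x y) ⟨by linarith, by linarith⟩ (dist y z) ⟨hyz, le_rfl⟩
      rw [hγ0, abs_of_nonpos (by linarith)] at e1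
      rw [hγ1, abs_of_nonpos (by linarith)] at e2
      rw [hδ0, abs_of_nonpos (by linarith)] at e3
      rw [hδ1, abs_of_nonpos (by linarith)] at e4
      have t1 := dist_triangle (γ s) y (δ (t - dist x y))
      have t2 := dist_triangle4 x (γ s) (δ (t - dist x y)) z
      exact le_antisymm (by linarith) (by linarith)
    · linarith
    · simp only [η, if_neg hs', if_neg ht']
      rw [hδ _ ⟨by linarith, by linarith⟩ _ ⟨by linarith, by linarith⟩, abs_of_nonpos (by linarith)]
      ring
  refine ⟨η, by simp [η, hxy, hγ0], ?_, fun s hs t ht => ?_⟩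
  · rcases hyz.eq_or_lt with h0 | h0
    · simp only [η]
      rw [if_pos (by linarith), hd, ← h0, add_zero, hγ1]
      exact dist_eq_zero.1 h0.symm
    · simp only [η]
      rw [if_neg (by linarith), hd, add_sub_cancel_left, hδ1]
  · rcases le_total s t with hst | hst
    · rw [key s t hs.1 hst ht.2, abs_of_nonpos (by linarith)]
      ring
    · rw [dist_comm, key t s ht.1 hst hs.2, abs_of_nonneg (by linarith)]

namespace Limit

theorem exists_geodesic_point (s t : unitInterval) (b : ℕ → Bool) :
    ∃ γ : ℝ → Limit, γ 0 = point s b ∧ γ (dist (point s b) (point t b)) = point t b ∧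
      ∀ u ∈ Set.Icc 0 (dist (point s b) (point t b)),
        ∀ v ∈ Set.Icc 0 (dist (point s b) (point t b)), dist (γ u) (γ v) = |u - v| := by
  have hs := s.2
  have ht := t.2
  -- The curve moves at unit speed in the direction `e` from height `s`.
  obtain ⟨e, he, het⟩ : ∃ e : ℝ, |e| = 1 ∧ s + e * |(s : ℝ) - t| = t := by
    rcases le_total (s : ℝ) t with h | h
    · exact ⟨1, abs_one, by rw [abs_of_nonpos (by linarith)]; ring⟩
    · exact ⟨-1, by simp, by rw [abs_of_nonneg (by linarith)]; ring⟩
  rw [dist_point]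
  have hmem : ∀ u ∈ Set.Icc 0 |(s : ℝ) - t|, (s : ℝ) + e * u ∈ Set.Icc (0 : ℝ) 1 := by
    intro u hu
    rcases (abs_eq zero_le_one).1 he with rfl | rfl
    · exact ⟨by linarith [hs.1, hu.1], by linarith [hu.2, ht.2]⟩
    · exact ⟨by linarith [hu.2, ht.1], by linarith [hu.1, hs.2]⟩
  refine ⟨fun u => point (Set.projIcc 0 1 zero_le_one (s + e * u)) b, ?_, ?_, ?_⟩
  · simp
  · simp only [het]
    simp
  · intro u hu v hv
    simp only [dist_point]
    rw [Set.projIcc_of_mem _ (hmem u hu), Set.projIcc_of_mem _ (hmem v hv)]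
    change |(s : ℝ) + e * u - (s + e * v)| = |u - v|
    rw [add_sub_add_left_eq_sub, ← mul_sub, abs_mul, he, one_mul]

theorem isGeodesicSpace : IsGeodesicSpace Limit := by
  intro x y
  obtain ⟨s, b, rfl⟩ := exists_point x
  obtain ⟨t, c, rfl⟩ := exists_point y
  obtain ⟨τ, hτ, hle⟩ := exists_agree_le_dist s t b c
  refine exists_geodesic_trans (y := point τ b) ?_ (exists_geodesic_point s τ b) ?_
  · rw [dist_point, point_eq_point hτ, dist_point]
    exact hle
  · rw [point_eq_point hτ]
    exact exists_geodesic_point τ t c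

/-! ### Balls and stars -/

/-- The points at height at most `ρ` from the vertex at height `v` over the choice `b`, in the
parametrization by heights and choices of branches. -/
def star (v : unitInterval) (b : ℕ → Bool) (ρ : ℝ) : Set (unitInterval × (ℕ → Bool)) :=
  {s : unitInterval | |(s : ℝ) - v| ≤ ρ} ×ˢ {c | Agree v b c}

/-- Every ball is contained in the star of a vertex of a generation whose edges have length
comparable to the radius. -/
theorem exists_ball_subset_star (t : unitInterval) (b : ℕ → Bool) {r : ℝ} (hr : 0 < r) :
    ∃ (n : ℕ) (v : unitInterval), IsGrid n v ∧ |(t : ℝ) - v| ≤ 1 / 4 ^ n / 2 ∧ 1 / 4 ^ n ≤ 8 * r ∧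
      (fun p : unitInterval × (ℕ → Bool) => point p.1 p.2) ⁻¹' Metric.ball (point t b) r ⊆
        star v b (1 / 4 ^ n) := by
  rcases le_or_gt r (1 / 2) with h | h
  · obtain ⟨n, hn1, hn2⟩ := exists_nat_pow_near_of_lt_one (x := 2 * r) (y := (1 / 4 : ℝ))
      (by linarith) (by linarith) (by norm_num) (by norm_num)
    rw [div_pow, one_pow] at hn1 hn2
    rw [pow_succ] at hn1
    obtain ⟨v, hv, hvt⟩ := exists_isGrid n t
    have hn3 : (1 : ℝ) / (4 ^ n * 4) = 1 / 4 ^ n / 4 := by rw [div_div]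
    refine ⟨n, v, hv, hvt, by linarith, ?_⟩
    rintro ⟨s, c⟩ hs
    obtain ⟨τ, hτ, hle⟩ := exists_agree_le_dist t s b c
    have hlt : dist (point s c) (point t b) < r := hs
    rw [dist_comm] at hlt
    have e1 := abs_sub_le (s : ℝ) τ v
    have e2 := abs_sub_le (τ : ℝ) t v
    rw [abs_sub_comm (τ : ℝ) t] at e2
    rw [abs_sub_comm (s : ℝ) τ] at e1
    have e3 := abs_nonneg ((τ : ℝ) - s)
    exact ⟨show |(s : ℝ) - v| ≤ _ by linarith, hv.agree hτ (by linarith)⟩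
  · -- For large radii the whole space is the star of an end of the unit segment.
    obtain ⟨v, hv, hvt⟩ := exists_isGrid 0 t
    refine ⟨0, v, hv, hvt, by norm_num; linarith, ?_⟩
    rintro ⟨s, c⟩ -
    refine ⟨?_, fun k => .inr (hv.not_mid (Nat.zero_le k))⟩
    change |(s : ℝ) - v| ≤ 1 / 4 ^ 0
    rw [abs_le]
    norm_num
    constructor <;> linarith [s.2.1, s.2.2, v.2.1, v.2.2]

theorem star_subset_ball {t v : unitInterval} {b : ℕ → Bool} {ρ r : ℝ} (h : ρ + |(t : ℝ) - v| < r) :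
    star v b ρ ⊆
      (fun p : unitInterval × (ℕ → Bool) => point p.1 p.2) ⁻¹' Metric.ball (point t b) r := by
  rintro ⟨s, c⟩ ⟨hs, hc⟩
  change |(s : ℝ) - v| ≤ ρ at hs
  change dist (point s c) (point t b) < r
  have := dist_le_of_agree hc t s
  rw [dist_comm, abs_sub_comm (v : ℝ)] at this
  linarith

end Limit

end Laakso

namespace Laakso

open LenGraph

/-! ### Integration over heights and choices of branches -/

theorem volume_setOf_coe_le (y : ℝ) :
    (volume : Measure unitInterval) {s | (s : ℝ) ≤ y} = ENNReal.ofReal (max 0 (min 1 y)) := by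
  rcases lt_or_ge y 0 with h | h
  · have : {s : unitInterval | (s : ℝ) ≤ y} = ∅ :=
      Set.eq_empty_of_forall_notMem fun s hs => absurd s.2.1 (not_le.2 (lt_of_le_of_lt hs h))
    rw [this, measure_empty, min_eq_right (by linarith), max_eq_left h.le, ENNReal.ofReal_zero]
  · have : {s : unitInterval | (s : ℝ) ≤ y} =
        Set.Iic ⟨min 1 y, le_min zero_le_one h, min_le_left _ _⟩ := by
      ext s
      rw [Set.mem_Iic, ← Subtype.coe_le_coe, le_min_iff]
      exact ⟨fun hs => ⟨s.2.2, hs⟩, fun hs => hs.2⟩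
    rw [this, unitInterval.volume_Iic, max_eq_right (le_min zero_le_one h)]

theorem coe_quarterPos_label (d : Fin 4) (β : Bool) (s : unitInterval) :
    (quarterPos (label d β) s : ℝ) = ((d : ℕ) + s) / 4 := by
  simp [quarterPos]

theorem measurable_quarterPos (i : Fin 6) : Measurable (quarterPos i) := by
  refine Measurable.subtype_mk ?_
  fun_prop

/-- Lebesgue measure on the unit interval is the mean of its images in the four quarters. -/
theorem volume_eq_sum_quarter : (volume : Measure unitInterval) =
    ∑ d : Fin 4, ENNReal.ofReal (1 / 4) • volume.map (quarterPos (label d true)) := by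
  refine Measure.ext_of_Iic _ _ fun x => ?_
  have h : ∀ d : Fin 4, (volume.map (quarterPos (label d true))) (Set.Iic x) =
      ENNReal.ofReal (max 0 (min 1 (4 * x - (d : ℕ)))) := by
    intro d
    rw [Measure.map_apply (measurable_quarterPos _) measurableSet_Iic, ← volume_setOf_coe_le]
    congr 1
    ext s
    rw [Set.mem_preimage, Set.mem_Iic, ← Subtype.coe_le_coe, Set.mem_ofPred_eq,
      coe_quarterPos_label, div_le_iff₀ (by norm_num)]
    constructor <;> intro h <;> linarith
  simp only [Measure.coe_finsetSum, Finset.sum_apply, Measure.smul_apply, h, smul_eq_mul,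
    unitInterval.volume_Iic]
  simp_rw [← ENNReal.ofReal_mul (by norm_num : (0 : ℝ) ≤ 1 / 4)]
  rw [← ENNReal.ofReal_sum_of_nonneg fun d _ => by positivity]
  congr 1
  have h0 := x.2.1
  have h1 := x.2.2
  have hc : ∀ d : ℝ, (4 * (x : ℝ) ≤ d ∧ max 0 (min 1 (4 * (x : ℝ) - d)) = 0) ∨
      (d ≤ 4 * (x : ℝ) ∧ 4 * (x : ℝ) ≤ d + 1 ∧
        max 0 (min 1 (4 * (x : ℝ) - d)) = 4 * (x : ℝ) - d) ∨
      (d + 1 ≤ 4 * (x : ℝ) ∧ max 0 (min 1 (4 * (x : ℝ) - d)) = 1) := by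
    intro d
    rcases le_total (4 * (x : ℝ)) d with h | h
    · exact .inl ⟨h, by rw [min_eq_right (by linarith), max_eq_left (by linarith)]⟩
    · rcases le_total (4 * (x : ℝ)) (d + 1) with h' | h'
      · exact .inr (.inl ⟨h, h', by rw [min_eq_right (by linarith), max_eq_right (by linarith)]⟩)
      · exact .inr (.inr ⟨h', by rw [min_eq_left (by linarith), max_eq_right (by linarith)]⟩)
  simp only [Fin.sum_univ_four, Fin.val_zero, Fin.val_one, Fin.val_two, Nat.cast_zero,
    Nat.cast_one, Nat.cast_ofNat, show ((3 : Fin 4) : ℕ) = 3 from rfl]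
  rcases hc 0 with ⟨a, e⟩ | ⟨a, a', e⟩ | ⟨a, e⟩ <;>
    rcases hc 1 with ⟨b, f⟩ | ⟨b, b', f⟩ | ⟨b, f⟩ <;>
    rcases hc 2 with ⟨c, g⟩ | ⟨c, c', g⟩ | ⟨c, g⟩ <;>
    rcases hc 3 with ⟨d, k⟩ | ⟨d, d', k⟩ | ⟨d, k⟩ <;> rw [e, f, g, k] <;> linarith

theorem quarterPos_label {d : Fin 4} {s : unitInterval} (hs : s ≠ 1) :
    digit (quarterPos (label d true) s) = d ∧ stretch (quarterPos (label d true) s) = s := by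
  have h1 : (s : ℝ) < 1 := lt_of_le_of_ne s.2.2 fun h => hs (Subtype.ext h)
  have h0 := s.2.1
  have hq := coe_quarterPos_label d true s
  have hd : digit (quarterPos (label d true) s) = d := by
    apply digit_eq <;> rw [hq] <;> linarith
  refine ⟨hd, Subtype.ext ?_⟩
  rw [coe_stretch, hd, hq]
  ring

theorem measurable_digit : Measurable digit := by
  have h : ∀ a : ℝ, MeasurableSet {s : unitInterval | (s : ℝ) < a} := fun a =>
    measurable_subtype_coe measurableSet_Iio
  unfold digit
  exact Measurable.ite (h _) measurable_const
    (Measurable.ite (h _) measurable_const (Measurable.ite (h _) measurable_const measurable_const))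

theorem measurable_stretch : Measurable stretch := by
  refine Measurable.subtype_mk ?_
  have : Measurable fun s => ((digit s : ℕ) : ℝ) :=
    (measurable_of_finite fun d : Fin 4 => ((d : ℕ) : ℝ)).comp measurable_digit
  fun_prop

theorem measurable_digit_stretch {f : Fin 4 → unitInterval → ℝ≥0∞} (hf : ∀ d, Measurable (f d)) :
    Measurable fun s => f (digit s) (stretch s) := by
  have : Measurable (Function.uncurry f) := measurable_from_prod_countable_right hf
  exact this.comp (measurable_digit.prodMk measurable_stretch)

/-- The quarter and the coordinate in it are independent and uniformly distributed. -/
theorem lintegral_digit_stretch {f : Fin 4 → unitInterval → ℝ≥0∞} (hf : ∀ d, Measurable (f d)) :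
    ∫⁻ s, f (digit s) (stretch s) = ∑ d, ENNReal.ofReal (1 / 4) * ∫⁻ s, f d s := by
  conv_lhs => rw [volume_eq_sum_quarter]
  rw [lintegral_finsetSum_measure]
  refine Finset.sum_congr rfl fun d _ => ?_
  rw [lintegral_smul_measure, lintegral_map (measurable_digit_stretch hf) (measurable_quarterPos _),
    smul_eq_mul]
  congr 1
  refine lintegral_congr_ae ?_
  have : ∀ᵐ s : unitInterval, s ≠ 1 := by simp [ae_iff]
  filter_upwards [this] with s hs
  rw [(quarterPos_label hs).1, (quarterPos_label hs).2]

/-- The law of the choice of a branch: top with probability `w`. -/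
noncomputable def branchMeasure (w : ℝ) : Measure Bool :=
  ENNReal.ofReal w • Measure.dirac true + ENNReal.ofReal (1 - w) • Measure.dirac false

theorem lintegral_branchMeasure (w : ℝ) (f : Bool → ℝ≥0∞) :
    ∫⁻ β, f β ∂branchMeasure w = ENNReal.ofReal w * f true + ENNReal.ofReal (1 - w) * f false := by
  simp [branchMeasure]

instance (w : Set.Ioo (0 : ℝ) 1) : IsProbabilityMeasure (branchMeasure w) where
  measure_univ := by
    have h0 := w.2.1
    have h1 := w.2.2
    simp only [branchMeasure, Measure.coe_add, Measure.coe_smul, Pi.add_apply, Pi.smul_apply,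
      measure_univ, smul_eq_mul, mul_one]
    rw [← ENNReal.ofReal_add h0.le (by linarith)]
    simp

/-- The law of independent choices of branches, one for each generation. -/
noncomputable def choiceMeasure (w : Set.Ioo (0 : ℝ) 1) : Measure (ℕ → Bool) :=
  Measure.infinitePi fun _ => branchMeasure w

instance (w : Set.Ioo (0 : ℝ) 1) : IsProbabilityMeasure (choiceMeasure w) := by
  unfold choiceMeasure
  infer_instance

theorem measurable_update_prod (n : ℕ) :
    Measurable fun p : (ℕ → Bool) × Bool => Function.update p.1 n p.2 := by
  refine measurable_pi_lambda _ fun k => ?_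
  by_cases h : k = n
  · subst h
    simpa using measurable_snd
  · simp only [Function.update_of_ne h]
    exact (measurable_pi_apply k).comp measurable_fst

/-- Replacing the choice in generation `n` by an independent one does not change the law. -/
theorem map_update_choiceMeasure (w : Set.Ioo (0 : ℝ) 1) (n : ℕ) :
    ((choiceMeasure w).prod (branchMeasure w)).map (fun p => Function.update p.1 n p.2) =
      choiceMeasure w := by
  refine Measure.eq_infinitePi _ fun s t ht => ?_
  rw [Measure.map_apply (measurable_update_prod n)
    (MeasurableSet.pi s.countable_toSet fun i _ => ht i)]
  by_cases hn : n ∈ s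
  · have : (fun p : (ℕ → Bool) × Bool => Function.update p.1 n p.2) ⁻¹' (s : Set ℕ).pi t =
        ((s.erase n : Finset ℕ) : Set ℕ).pi t ×ˢ t n := by
      ext ⟨b, β⟩
      simp only [Set.mem_preimage, Set.mem_pi, Finset.mem_coe, Set.mem_prod, Finset.mem_erase]
      constructor
      · refine fun h => ⟨fun i hi => ?_, by simpa using h n hn⟩
        simpa [Function.update_of_ne hi.1] using h i hi.2
      · rintro ⟨h, h'⟩ i hi
        by_cases hin : i = n
        · subst hin
          simpa using h'
        · simpa [Function.update_of_ne hin] using h i ⟨hin, hi⟩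
    rw [this, Measure.prod_prod, choiceMeasure, Measure.infinitePi_pi _ fun i _ => ht i,
      Finset.prod_erase_mul _ _ hn]
  · have : (fun p : (ℕ → Bool) × Bool => Function.update p.1 n p.2) ⁻¹' (s : Set ℕ).pi t =
        (s : Set ℕ).pi t ×ˢ Set.univ := by
      ext ⟨b, β⟩
      simp only [Set.mem_preimage, Set.mem_pi, Finset.mem_coe, Set.mem_prod, Set.mem_univ, and_true]
      refine forall₂_congr fun i hi => ?_
      rw [Function.update_of_ne (show i ≠ n from fun h => hn (h ▸ hi))]
    rw [this, Measure.prod_prod, choiceMeasure, Measure.infinitePi_pi _ fun i _ => ht i,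
      measure_univ, mul_one]

/-- The choice of branch in generation `n` is independent of the others. -/
theorem lintegral_choiceMeasure_eval (w : Set.Ioo (0 : ℝ) 1) (n : ℕ)
    {f : Bool → (ℕ → Bool) → ℝ≥0∞} (hf : ∀ β, Measurable (f β))
    (hn : ∀ β β' b, f β (Function.update b n β') = f β b) :
    ∫⁻ b, f (b n) b ∂choiceMeasure w =
      ∫⁻ b, (ENNReal.ofReal w * f true b + ENNReal.ofReal (1 - w) * f false b)
        ∂choiceMeasure w := by
  have hf' : Measurable fun p : Bool × (ℕ → Bool) => f p.1 p.2 :=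
    measurable_from_prod_countable_right hf
  have hm : Measurable fun b : ℕ → Bool => f (b n) b :=
    hf'.comp ((measurable_pi_apply n).prodMk measurable_id :
      Measurable fun b : ℕ → Bool => (b n, b))
  conv_lhs => rw [← map_update_choiceMeasure w n]
  rw [lintegral_map hm (measurable_update_prod n),
    lintegral_prod (fun p : (ℕ → Bool) × Bool =>
      f (Function.update p.1 n p.2 n) (Function.update p.1 n p.2))
      (hm.comp (measurable_update_prod n)).aemeasurable]
  refine lintegral_congr fun b => ?_
  simp only [Function.update_self, hn]
  exact lintegral_branchMeasure _ _

/-- The law of a uniformly distributed height and independent choices of branches. -/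
noncomputable def paramMeasure (w : Set.Ioo (0 : ℝ) 1) : Measure (unitInterval × (ℕ → Bool)) :=
  (volume : Measure unitInterval).prod (choiceMeasure w)

instance (w : Set.Ioo (0 : ℝ) 1) : IsProbabilityMeasure (paramMeasure w) := by
  unfold paramMeasure
  infer_instance

theorem edgeAt_update {n k : ℕ} (h : k ≤ n) (t : unitInterval) (b : ℕ → Bool) (β : Bool) :
    edgeAt (Function.update b n β) t k = edgeAt b t k := by
  induction k with
  | zero => rfl
  | succ k ih => rw [edgeAt, edgeAt, ih (by omega), Function.update_of_ne (by omega)]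

theorem param_update (n : ℕ) (t : unitInterval) (b : ℕ → Bool) (β : Bool) :
    param n t (Function.update b n β) = param n t b := by
  rw [param, param, edgeAt_update le_rfl]

theorem measurable_lift {G : LenGraph} (β : Bool) : Measurable (lift β : G.Space → _) := by
  refine (LipschitzWith.continuous (K := 1) fun z z' => ?_).measurable
  rw [ENNReal.coe_one, one_mul]
  exact edist_lift_lift_le β z z'

theorem continuous_param (n : ℕ) :
    Continuous fun p : unitInterval × (ℕ → Bool) => param n p.1 p.2 :=
  (Limit.lipschitzWith_coord n).continuous.comp Limit.continuous_point

theorem lintegral_graphMeasure (w : ℝ) (n : ℕ) {f : (graph n).Space → ℝ≥0∞} (hf : Measurable f) :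
    ∫⁻ z, f z ∂graphMeasure w n =
      ∑' e, edgeMass w n e * ∫⁻ s, f (Space.mk (graph n) e s) := by
  rw [graphMeasure, lintegral_sum_measure]
  refine tsum_congr fun e => ?_
  rw [lintegral_smul_measure, lintegral_map hf (Space.continuous_mk e).measurable, smul_eq_mul]

theorem split_label (w : ℝ) (hw : w ∈ Set.Ioo (0 : ℝ) 1) (f : Fin 6 → ℝ≥0∞) :
    ∑ i, split w i * f i = ENNReal.ofReal w * ∑ d, ENNReal.ofReal (1 / 4) * f (label d true) +
      ENNReal.ofReal (1 - w) * ∑ d, ENNReal.ofReal (1 / 4) * f (label d false) := by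
  have h0 := hw.1.le
  have h1 : 0 ≤ 1 - w := by linarith [hw.2]
  have e1 : ENNReal.ofReal (w / 4) = ENNReal.ofReal w * ENNReal.ofReal (1 / 4) := by
    rw [← ENNReal.ofReal_mul h0, mul_one_div]
  have e2 : ENNReal.ofReal ((1 - w) / 4) = ENNReal.ofReal (1 - w) * ENNReal.ofReal (1 / 4) := by
    rw [← ENNReal.ofReal_mul h1, mul_one_div]
  have e3 : ENNReal.ofReal (1 / 4) =
      (ENNReal.ofReal w + ENNReal.ofReal (1 - w)) * ENNReal.ofReal (1 / 4) := by
    rw [← ENNReal.ofReal_add h0 h1]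
    simp
  have s0 : split w 0 = ENNReal.ofReal (1 / 4) := rfl
  have s1 : split w 1 = ENNReal.ofReal (w / 4) := rfl
  have s2 : split w 2 = ENNReal.ofReal (w / 4) := rfl
  have s3 : split w 3 = ENNReal.ofReal ((1 - w) / 4) := rfl
  have s4 : split w 4 = ENNReal.ofReal ((1 - w) / 4) := rfl
  have s5 : split w 5 = ENNReal.ofReal (1 / 4) := rfl
  rw [Fin.sum_univ_six, Fin.sum_univ_four, Fin.sum_univ_four, s1, s2, s3, s4, e1, e2]
  simp only [label]
  rw [s0.trans e3, s5.trans e3]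
  ring

/-- Height and choices distribute the parametrized point of the `n`-th graph according to the given
measure on that graph. -/
theorem lintegral_param (w : Set.Ioo (0 : ℝ) 1) (n : ℕ) {f : (graph n).Space → ℝ≥0∞}
    (hf : Measurable f) :
    ∫⁻ p, f (param n p.1 p.2) ∂paramMeasure w = ∫⁻ z, f z ∂graphMeasure w n := by
  induction n with
  | zero =>
    rw [lintegral_graphMeasure _ _ hf, paramMeasure,
      lintegral_prod (fun p => f (param 0 p.1 p.2))
        (hf.comp (continuous_param 0).measurable).aemeasurable]
    have h : ∀ (t : unitInterval) (b : ℕ → Bool),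
      f (param 0 t b) = f (Space.mk (graph 0) () t) := fun _ _ => rfl
    simp only [h, lintegral_const, measure_univ, mul_one]
    have h1 : ∀ F : Unit → ℝ≥0∞, ∑' e, F e = F () := fun F => by simp
    have h2 : edgeMass w 0 () * ∫⁻ s, f (Space.mk (graph 0) () s) =
        ∫⁻ s, f (Space.mk (graph 0) () s) := one_mul _
    exact ((h1 fun e => edgeMass w 0 e * ∫⁻ s, f (Space.mk (graph 0) e s)).trans h2).symm
  | succ n ih =>
    let f' : Bool → (graph n).Space → ℝ≥0∞ := fun β z => f (lift β z)
    have hf' : ∀ β, Measurable (f' β) := fun β => hf.comp (measurable_lift β)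
    have hpar : ∀ t, Measurable (param n t) := fun t =>
      (continuous_param n).measurable.comp measurable_prodMk_left
    -- Integrate over the choice of branch in generation `n` first.
    have step : ∫⁻ p, f (param (n + 1) p.1 p.2) ∂paramMeasure w =
        ∫⁻ p, (ENNReal.ofReal w * f' true (param n p.1 p.2) +
          ENNReal.ofReal (1 - w) * f' false (param n p.1 p.2)) ∂paramMeasure w := by
      have hg : Measurable fun z =>
          ENNReal.ofReal w * f' true z + ENNReal.ofReal (1 - w) * f' false z :=
        ((hf' true).const_mul _).add ((hf' false).const_mul _)
      rw [paramMeasure, lintegral_prod (fun p => f (param (n + 1) p.1 p.2))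
        (hf.comp (continuous_param (n + 1)).measurable).aemeasurable,
        lintegral_prod (fun p => ENNReal.ofReal w * f' true (param n p.1 p.2) +
          ENNReal.ofReal (1 - w) * f' false (param n p.1 p.2))
        (hg.comp (continuous_param n).measurable).aemeasurable]
      refine lintegral_congr fun t => ?_
      exact lintegral_choiceMeasure_eval w n (f := fun β b => f' β (param n t b))
        (fun β => (hf' β).comp (hpar t)) fun β β' b => by simp only [param_update]
    rw [step, ih (f := fun z => ENNReal.ofReal w * f' true z + ENNReal.ofReal (1 - w) * f' false z)
      (((hf' true).const_mul _).add ((hf' false).const_mul _)), lintegral_graphMeasure,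
      lintegral_graphMeasure _ _ hf]
    · have hsum : (∑' e, edgeMass w (n + 1) e * ∫⁻ s, f (Space.mk (graph (n + 1)) e s)) =
          ∑' (e : (graph n).E) (i : Fin 6), edgeMass w n e * split w i *
            ∫⁻ s, f (Space.mk (graph n).diamond (newEdge e i) s) :=
        ENNReal.tsum_prod (f := fun (e : (graph n).E) (i : Fin 6) => edgeMass w n e * split w i *
            ∫⁻ s, f (Space.mk (graph n).diamond (newEdge e i) s))
      refine Eq.trans (tsum_congr fun e => ?_) hsum.symm
      have hmk : ∀ i, Measurable fun s => f (Space.mk (graph n).diamond (newEdge e i) s) :=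
        fun i => hf.comp (Space.continuous_mk _).measurable
      have hl : ∀ β, ∫⁻ s, f' β (Space.mk (graph n) e s) = ∑ d, ENNReal.ofReal (1 / 4) *
          ∫⁻ s, f (Space.mk (graph n).diamond (newEdge e (label d β)) s) := fun β =>
        lintegral_digit_stretch fun d => hmk (label d β)
      rw [lintegral_add_left, lintegral_const_mul, lintegral_const_mul, hl, hl,
        ← split_label w w.2 fun i => ∫⁻ s, f (Space.mk (graph n).diamond (newEdge e i) s),
        tsum_fintype, Finset.mul_sum]
      · exact Finset.sum_congr rfl fun i _ => (mul_assoc _ _ _).symm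
      · exact (hf' false).comp (Space.continuous_mk e).measurable
      · exact (hf' true).comp (Space.continuous_mk e).measurable
      · exact ((hf' true).comp (Space.continuous_mk e).measurable).const_mul _
    · exact ((hf' true).const_mul _).add ((hf' false).const_mul _)

namespace Limit

theorem measurable_point : Measurable fun p : unitInterval × (ℕ → Bool) => point p.1 p.2 :=
  continuous_point.measurable

/-- The measure on the inverse limit with parameter `w`. -/
noncomputable def measure (w : Set.Ioo (0 : ℝ) 1) : Measure Limit :=
  (paramMeasure w).map fun p => point p.1 p.2

instance (w : Set.Ioo (0 : ℝ) 1) : IsProbabilityMeasure (measure w) :=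
  Measure.isProbabilityMeasure_map measurable_point.aemeasurable

theorem map_coord_measure (w : Set.Ioo (0 : ℝ) 1) (n : ℕ) :
    (measure w).map (coord n) = graphMeasure w n := by
  have hc : Measurable (coord n) := (lipschitzWith_coord n).continuous.measurable
  refine Measure.ext_of_lintegral _ fun f hf => ?_
  rw [lintegral_map hf hc, measure,
    lintegral_map (f := fun x => f (coord n x)) (hf.comp hc) measurable_point]
  exact lintegral_param w n hf

end Limit

end Laakso

namespace Laakso

open LenGraph

/-! ### The mass of stars and the doubling property -/

theorem branchMeasure_singleton (w : ℝ) (β : Bool) :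
    branchMeasure w {β} = ENNReal.ofReal (if β then w else 1 - w) := by
  cases β <;> simp [branchMeasure]

theorem measurableSet_agree (v : unitInterval) (b : ℕ → Bool) :
    MeasurableSet {c | Agree v b c} := by
  have : {c | Agree v b c} = ⋂ k, {c : ℕ → Bool | b k = c k ∨ ¬ Mid k v} := by
    ext c
    simp [Agree]
  rw [this]
  refine MeasurableSet.iInter fun k => ?_
  by_cases h : Mid k v
  · simp only [h, not_true_eq_false, or_false]
    exact measurable_pi_apply k (measurableSet_eq_fun measurable_const measurable_id)
  · simp [h]

open Classical in
theorem choiceMeasure_agree (w : Set.Ioo (0 : ℝ) 1) {n : ℕ} {v : unitInterval} (hv : IsGrid n v)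
    (b : ℕ → Bool) : choiceMeasure w {c | Agree v b c} =
      ∏ j ∈ (Finset.range n).filter (Mid · v), branchMeasure w {b j} := by
  have : {c | Agree v b c} =
      ((Finset.range n).filter (Mid · v) : Set ℕ).pi fun j => ({b j} : Set Bool) := by
    ext c
    simp only [Set.mem_pi, Finset.mem_coe, Finset.mem_filter, Finset.mem_range,
      Set.mem_singleton_iff]
    constructor
    · intro h j hj
      exact ((h j).resolve_right (not_not.2 hj.2)).symm
    · intro h j
      by_cases hj : Mid j v
      · refine .inl (h j ⟨?_, hj⟩).symm
        by_contra hn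
        exact hv.not_mid (not_lt.1 hn) hj
      · exact .inr hj
  rw [this, choiceMeasure, Measure.infinitePi_pi _ fun _ _ => measurableSet_singleton _]

/-- If a vertex height `v` of generation `n` does not lie strictly between the ends of the branches
of a diamond of generation `j`, but a height in an adjacent cell does, then `v` is the height of one
of these ends, an odd multiple of `4⁻¹ ^ (j + 1)`. -/
theorem IsGrid.exists_odd {n j : ℕ} {v v' : unitInterval} (hv : IsGrid n v) (hj : j < n)
    (hd : |(v' : ℝ) - v| < 1 / 4 ^ n) (h : ¬ Mid j v) (h' : Mid j v') :
    ∃ a : ℤ, 4 ^ (j + 1) * (v : ℝ) = 2 * a + 1 := by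
  obtain ⟨N, hN⟩ := hv
  obtain ⟨i, rfl⟩ := Nat.exists_eq_add_of_lt hj
  obtain ⟨m, h0, h1⟩ := mid_iff.1 h'
  have hi : (0 : ℝ) < 4 ^ i := by positivity
  rw [pow_succ, pow_add] at hN hd
  rw [lt_div_iff₀ (by positivity), ← abs_of_pos (by positivity : (0 : ℝ) < 4 ^ j * 4 ^ i * 4),
    ← abs_mul, abs_lt] at hd
  have h0' := mul_lt_mul_of_pos_left h0 hi
  have h1' := mul_lt_mul_of_pos_left h1 hi
  have e0 : 4 ^ i * (4 * m + 1) ≤ N := by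
    have : ((4 ^ i * (4 * m + 1) : ℤ) : ℝ) < N + 1 := by
      push_cast
      linarith [hd.2]
    have : 4 ^ i * (4 * m + 1) < N + 1 := by exact_mod_cast this
    omega
  have e1 : N ≤ 4 ^ i * (4 * m + 3) := by
    have : (N : ℝ) < ((4 ^ i * (4 * m + 3) : ℤ) : ℝ) + 1 := by
      push_cast
      linarith [hd.1]
    have : N < 4 ^ i * (4 * m + 3) + 1 := by exact_mod_cast this
    omega
  have e0' : (4 : ℝ) ^ i * (4 * m + 1) ≤ N := by exact_mod_cast e0
  have e1' : (N : ℝ) ≤ 4 ^ i * (4 * m + 3) := by exact_mod_cast e1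
  have l0 : (m : ℝ) + 1 / 4 ≤ 4 ^ j * v := by
    refine le_of_mul_le_mul_left ?_ (by positivity : (0 : ℝ) < 4 ^ i * 4)
    linarith
  have l1 : 4 ^ j * (v : ℝ) ≤ m + 3 / 4 := by
    refine le_of_mul_le_mul_left ?_ (by positivity : (0 : ℝ) < 4 ^ i * 4)
    linarith
  rw [pow_succ]
  rcases l0.eq_or_lt with h2 | h2
  · exact ⟨2 * m, by push_cast; linarith⟩
  · rcases l1.eq_or_lt with h3 | h3
    · exact ⟨2 * m + 1, by push_cast; linarith⟩
    · exact absurd (mid_iff.2 ⟨m, h2, h3⟩) h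

/-- A height is the end of branches of diamonds in at most one generation. -/
theorem not_odd_of_lt {i j : ℕ} (hij : i < j) {x : ℝ} {a a' : ℤ}
    (h : 4 ^ (i + 1) * x = 2 * a + 1) (h' : 4 ^ (j + 1) * x = 2 * a' + 1) : False := by
  obtain ⟨k, rfl⟩ := Nat.exists_eq_add_of_lt hij
  have : (4 : ℝ) ^ (i + k + 1 + 1) * x = 4 * (4 ^ k * (2 * a + 1)) := by
    rw [← h]
    ring
  rw [this] at h'
  have h'' : 4 * (4 ^ k * (2 * a + 1)) = 2 * a' + 1 := by exact_mod_cast h'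
  omega

open Classical in
/-- The set of choices that agree with `b` at a vertex height of generation `n + 3` near a vertex
height of generation `n` is a substantial part of those that agree with `b` at the latter: at most
four more choices are prescribed. -/
theorem choiceMeasure_agree_le (w : Set.Ioo (0 : ℝ) 1) {n : ℕ} {v v' : unitInterval}
    (hv : IsGrid n v) (hv' : IsGrid (n + 3) v') (hd : |(v' : ℝ) - v| < 1 / 4 ^ n) (b : ℕ → Bool) :
    ENNReal.ofReal (min w (1 - w)) ^ 4 * choiceMeasure w {c | Agree v b c} ≤
      choiceMeasure w {c | Agree v' b c} := by
  rw [choiceMeasure_agree w hv, choiceMeasure_agree w hv']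
  set M := (Finset.range n).filter (Mid · v)
  set M' := (Finset.range (n + 3)).filter (Mid · v')
  set δ := ENNReal.ofReal (min w (1 - w)) with hδ
  have hle : ∀ j, branchMeasure w {b j} ≤ 1 := fun j => prob_le_one
  have hge : ∀ j, δ ≤ branchMeasure w {b j} := fun j => by
    rw [branchMeasure_singleton, hδ]
    refine ENNReal.ofReal_le_ofReal ?_
    split_ifs
    exacts [min_le_left _ _, min_le_right _ _]
  have hδ1 : δ ≤ 1 := (hge 0).trans (hle 0)
  have hcard : (M' \ M).card ≤ 4 := by
    have hsub : M' \ M ⊆ ((M' \ M).filter (· < n)) ∪ Finset.Ico n (n + 3) := by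
      intro j hj
      have hj' := (Finset.mem_range.1 (Finset.mem_filter.1 (Finset.mem_sdiff.1 hj).1).1)
      by_cases h : j < n
      · exact Finset.mem_union_left _ (Finset.mem_filter.2 ⟨hj, h⟩)
      · exact Finset.mem_union_right _ (Finset.mem_Ico.2 ⟨not_lt.1 h, hj'⟩)
    have hone : ((M' \ M).filter (· < n)).card ≤ 1 := by
      have hodd : ∀ j ∈ (M' \ M).filter (· < n), ∃ a : ℤ, 4 ^ (j + 1) * (v : ℝ) = 2 * a + 1 := by
        intro j hj
        simp only [M, M', Finset.mem_filter, Finset.mem_sdiff, Finset.mem_range, not_and] at hj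
        exact hv.exists_odd hj.2 hd (hj.1.2 hj.2) hj.1.1.2
      rw [Finset.card_le_one]
      intro i hi j hj
      obtain ⟨a, ha⟩ := hodd i hi
      obtain ⟨a', ha'⟩ := hodd j hj
      rcases lt_trichotomy i j with h | h | h
      · exact (not_odd_of_lt h ha ha').elim
      · exact h
      · exact (not_odd_of_lt h ha' ha).elim
    refine (Finset.card_le_card hsub).trans ((Finset.card_union_le _ _).trans ?_)
    rw [Nat.card_Ico]
    omega
  calc δ ^ 4 * ∏ j ∈ M, branchMeasure w {b j}
      ≤ (∏ j ∈ M' \ M, branchMeasure w {b j}) * ∏ j ∈ M, branchMeasure w {b j} := by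
        refine mul_le_mul_left ?_ _
        calc δ ^ 4 ≤ δ ^ (M' \ M).card := pow_le_pow_right_of_le_one' hδ1 hcard
          _ = ∏ j ∈ M' \ M, δ := (Finset.prod_const _).symm
          _ ≤ _ := Finset.prod_le_prod' fun j _ => hge j
    _ = ∏ j ∈ M' ∪ M, branchMeasure w {b j} := by
        rw [← Finset.prod_union Finset.sdiff_disjoint, Finset.sdiff_union_self_eq_union]
    _ ≤ ∏ j ∈ M', branchMeasure w {b j} :=
        Finset.prod_le_prod_of_subset_of_le_one' Finset.subset_union_left fun j _ _ => hle j

theorem choiceMeasure_agree_pos (w : Set.Ioo (0 : ℝ) 1) {n : ℕ} {v : unitInterval}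
    (hv : IsGrid n v) (b : ℕ → Bool) : 0 < choiceMeasure w {c | Agree v b c} := by
  classical
  rw [choiceMeasure_agree w hv, pos_iff_ne_zero, Finset.prod_ne_zero_iff]
  intro j _
  rw [branchMeasure_singleton, ne_eq, ENNReal.ofReal_eq_zero, not_le]
  split_ifs
  exacts [w.2.1, by linarith [w.2.2]]

theorem measurableSet_abs_sub_le (v : unitInterval) (ρ : ℝ) :
    MeasurableSet {s : unitInterval | |(s : ℝ) - v| ≤ ρ} :=
  (isClosed_le (by fun_prop) continuous_const).measurableSet

theorem volume_abs_sub_le (v : unitInterval) (ρ : ℝ) :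
    (volume : Measure unitInterval) {s | |(s : ℝ) - v| ≤ ρ} ≤ ENNReal.ofReal (2 * ρ) := by
  rw [unitInterval.volume_apply]
  refine (measure_mono (t := Set.Icc ((v : ℝ) - ρ) (v + ρ)) ?_).trans ?_
  · rintro _ ⟨s, hs, rfl⟩
    have := abs_le.1 (show |(s : ℝ) - v| ≤ ρ from hs)
    exact ⟨by linarith [this.1], by linarith [this.2]⟩
  · rw [Real.volume_Icc]
    exact ENNReal.ofReal_le_ofReal (by linarith)

theorem le_volume_abs_sub_le (v : unitInterval) {ρ : ℝ} (h0 : 0 ≤ ρ) (h1 : ρ ≤ 1) :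
    ENNReal.ofReal ρ ≤ (volume : Measure unitInterval) {s | |(s : ℝ) - v| ≤ ρ} := by
  have v0 := v.2.1
  have v1 := v.2.2
  let x : unitInterval := ⟨max 0 (v - ρ), le_max_left _ _, max_le zero_le_one (by linarith)⟩
  let y : unitInterval := ⟨min 1 (v + ρ), le_min zero_le_one (by linarith), min_le_left _ _⟩
  calc ENNReal.ofReal ρ ≤ ENNReal.ofReal (y - x) := by
        refine ENNReal.ofReal_le_ofReal ?_
        simp only [x, y]
        rcases max_cases (0 : ℝ) (v - ρ) with ⟨e, _⟩ | ⟨e, _⟩ <;>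
          rcases min_cases (1 : ℝ) (v + ρ) with ⟨e', _⟩ | ⟨e', _⟩ <;> rw [e, e'] <;> linarith
    _ = volume (Set.Icc x y) := (unitInterval.volume_Icc x y).symm
    _ ≤ _ := measure_mono fun s hs => by
        have h2 : max 0 ((v : ℝ) - ρ) ≤ s := hs.1
        have h3 : (s : ℝ) ≤ min 1 (v + ρ) := hs.2
        exact show |(s : ℝ) - v| ≤ ρ from abs_le.2 ⟨by linarith [le_max_right 0 ((v : ℝ) - ρ)],
          by linarith [min_le_right 1 ((v : ℝ) + ρ)]⟩

namespace Limit

theorem paramMeasure_star (w : Set.Ioo (0 : ℝ) 1) (v : unitInterval) (b : ℕ → Bool) (ρ : ℝ) :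
    paramMeasure w (star v b ρ) =
      volume {s : unitInterval | |(s : ℝ) - v| ≤ ρ} * choiceMeasure w {c | Agree v b c} :=
  Measure.prod_prod _ _

theorem measure_ball (w : Set.Ioo (0 : ℝ) 1) (x : Limit) (r : ℝ) : measure w (Metric.ball x r) =
    paramMeasure w ((fun p : unitInterval × (ℕ → Bool) => point p.1 p.2) ⁻¹' Metric.ball x r) :=
  Measure.map_apply measurable_point Metric.isOpen_ball.measurableSet

theorem one_div_pow_add_three (n : ℕ) : (1 : ℝ) / 4 ^ (n + 3) = 1 / 4 ^ n / 64 := by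
  rw [pow_add, div_div]
  norm_num

/-- The doubling inequality. The factor `128` bounds the ratio of the lengths of the intervals of
heights, and at most four choices of branches, each of probability at least `min w (1 - w)`, account for the
ratio of the masses of the cylinders of choices. -/
theorem measure_ball_pos_and_le (w : Set.Ioo (0 : ℝ) 1) (x : Limit) {r : ℝ} (hr : 0 < r) :
    0 < measure w (Metric.ball x r) ∧ measure w (Metric.ball x (2 * r)) *
      ENNReal.ofReal (min w (1 - w)) ^ 4 ≤ 128 * measure w (Metric.ball x r) := by
  obtain ⟨t, b, rfl⟩ := exists_point x
  obtain ⟨n, v, hv, hvt, hnr, hsub⟩ := exists_ball_subset_star t b (by linarith : 0 < 2 * r)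
  -- A vertex whose star is contained in the ball.
  obtain ⟨v', hv', hvt'⟩ := exists_isGrid (n + 3) t
  have hn : (0 : ℝ) < 1 / 4 ^ n := by positivity
  have hn1 : (1 : ℝ) / 4 ^ n ≤ 1 := by
    rw [div_le_one (by positivity)]
    exact one_le_pow₀ (by norm_num)
  have h3 := one_div_pow_add_three n
  have hsub' := star_subset_ball (t := t) (v := v') (b := b) (ρ := 1 / 4 ^ (n + 3)) (r := r)
    (by linarith)
  have hlow : ENNReal.ofReal (1 / 4 ^ (n + 3)) * choiceMeasure w {c | Agree v' b c} ≤
      measure w (Metric.ball (point t b) r) := by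
    rw [measure_ball]
    refine le_trans ?_ (measure_mono hsub')
    rw [paramMeasure_star]
    exact mul_le_mul_left (le_volume_abs_sub_le v' (by linarith) (by linarith)) _
  refine ⟨lt_of_lt_of_le (ENNReal.mul_pos ?_ (choiceMeasure_agree_pos w hv' b).ne') hlow, ?_⟩
  · rw [ne_eq, ENNReal.ofReal_eq_zero, not_le]
    positivity
  have hup : measure w (Metric.ball (point t b) (2 * r)) ≤
      ENNReal.ofReal (2 * (1 / 4 ^ n)) * choiceMeasure w {c | Agree v b c} := by
    rw [measure_ball]
    refine (measure_mono hsub).trans ?_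
    rw [paramMeasure_star]
    exact mul_le_mul_left (volume_abs_sub_le v _) _
  have hvv : |(v' : ℝ) - v| < 1 / 4 ^ n := by
    have := abs_sub_le (v' : ℝ) t v
    rw [abs_sub_comm (v' : ℝ) t] at this
    linarith
  calc _ ≤ ENNReal.ofReal (2 * (1 / 4 ^ n)) * choiceMeasure w {c | Agree v b c} *
        ENNReal.ofReal (min w (1 - w)) ^ 4 := mul_le_mul_left hup _
    _ = ENNReal.ofReal (2 * (1 / 4 ^ n)) * (ENNReal.ofReal (min w (1 - w)) ^ 4 *
        choiceMeasure w {c | Agree v b c}) := by ring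
    _ ≤ ENNReal.ofReal (2 * (1 / 4 ^ n)) * choiceMeasure w {c | Agree v' b c} :=
        mul_le_mul_right (choiceMeasure_agree_le w hv hv' hvv b) _
    _ = 128 * (ENNReal.ofReal (1 / 4 ^ (n + 3)) * choiceMeasure w {c | Agree v' b c}) := by
        rw [← mul_assoc, ← ENNReal.ofReal_ofNat, ← ENNReal.ofReal_mul (by norm_num), h3]
        congr 2
        ring
    _ ≤ _ := mul_le_mul_right hlow _

theorem isDoublingMeasure (w : Set.Ioo (0 : ℝ) 1) : IsDoublingMeasure (measure w) := by
  have hmin : 0 < min (w : ℝ) (1 - w) := lt_min w.2.1 (by linarith [w.2.2])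
  have hδ : ENNReal.ofReal (min w (1 - w)) ^ 4 ≠ 0 :=
    pow_ne_zero _ (by rwa [ne_eq, ENNReal.ofReal_eq_zero, not_le])
  have hδ' : ENNReal.ofReal (min w (1 - w)) ^ 4 ≠ ⊤ := ENNReal.pow_ne_top ENNReal.ofReal_ne_top
  refine ⟨(128 / ENNReal.ofReal (min w (1 - w)) ^ 4).toNNReal, fun x r hr => ?_⟩
  obtain ⟨h1, h2⟩ := measure_ball_pos_and_le w x hr
  refine ⟨h1, measure_lt_top _ _, ?_⟩
  rw [ENNReal.coe_toNNReal (ENNReal.div_ne_top (by norm_num) hδ), ENNReal.mul_comm_div,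
    ← ENNReal.mul_comm_div, ← ENNReal.mul_div_right_comm]
  exact (ENNReal.le_div_iff_mul_le (.inl hδ) (.inl hδ')).2 h2

end Limit

/-! ### The Poincaré inequality -/

/-- A curve that preserves distances is parametrized by arclength. -/
theorem hasUnitSpeedOn_of_dist_eq {X : Type*} [MetricSpace X] {γ : ℝ → X} {S : Set ℝ}
    (h : ∀ x ∈ S, ∀ y ∈ S, dist (γ x) (γ y) = |x - y|) : HasUnitSpeedOn γ S := by
  refine hasConstantSpeedOnWith_iff_ordered.2 fun x hx y hy hxy => ?_
  have hvar : eVariationOn γ (S ∩ Set.Icc x y) = eVariationOn (id : ℝ → ℝ) (S ∩ Set.Icc x y) := by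
    unfold eVariationOn
    refine iSup_congr fun p => Finset.sum_congr rfl fun i _ => ?_
    rw [edist_dist, edist_dist, h _ (p.2.2.2 _).1 _ (p.2.2.2 _).1, Real.dist_eq]
    rfl
  rw [hvar, NNReal.coe_one, one_mul]
  exact (monotone_id.monotoneOn S).eVariationOn_eq hx hy

/-- The mean distance to the mean is at most twice the mean distance to any other value. -/
theorem lintegral_abs_sub_integral_le {X : Type*} [MeasurableSpace X] {ν : Measure X}
    [IsProbabilityMeasure ν] {u : X → ℝ} (hu : Integrable u ν) (a : ℝ) :
    ∫⁻ y, ENNReal.ofReal |u y - ∫ z, u z ∂ν| ∂ν ≤ 2 * ∫⁻ y, ENNReal.ofReal |u y - a| ∂ν := by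
  have hm : ENNReal.ofReal |a - ∫ z, u z ∂ν| ≤ ∫⁻ y, ENNReal.ofReal |u y - a| ∂ν := by
    have : (∫ z, u z ∂ν) - a = ∫ z, (u z - a) ∂ν := by
      rw [integral_sub hu (integrable_const a)]
      simp
    rw [abs_sub_comm, this, ← Real.enorm_eq_ofReal_abs]
    refine (enorm_integral_le_lintegral_enorm _).trans (le_of_eq ?_)
    simp only [Real.enorm_eq_ofReal_abs]
  calc ∫⁻ y, ENNReal.ofReal |u y - ∫ z, u z ∂ν| ∂ν
      ≤ ∫⁻ y, (ENNReal.ofReal |u y - a| + ENNReal.ofReal |a - ∫ z, u z ∂ν|) ∂ν := by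
        refine lintegral_mono fun y => ?_
        rw [← ENNReal.ofReal_add (abs_nonneg _) (abs_nonneg _)]
        exact ENNReal.ofReal_le_ofReal (abs_sub_le _ _ _)
    _ = ∫⁻ y, ENNReal.ofReal |u y - a| ∂ν + ENNReal.ofReal |a - ∫ z, u z ∂ν| := by
        rw [lintegral_add_right _ measurable_const, lintegral_const, measure_univ, mul_one]
    _ ≤ _ := by
        rw [two_mul]
        gcongr

namespace Limit

variable {u : Limit → ℝ} {g : Limit → ℝ≥0∞}

theorem measurable_point_left (c : ℕ → Bool) : Measurable fun t => point t c :=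
  measurable_point.comp measurable_prodMk_right

/-- The upper gradient inequality along the monotone geodesic with given choices of branches. -/
theorem ofReal_abs_sub_le (h : IsUpperGradient g u) (s t : unitInterval) (c : ℕ → Bool) :
    ENNReal.ofReal |u (point t c) - u (point s c)| ≤ ∫⁻ τ in Set.uIcc s t, g (point τ c) := by
  wlog hst : s ≤ t generalizing s t
  · rw [abs_sub_comm, Set.uIcc_comm]
    exact this t s (le_of_not_ge hst)
  have hst' : (s : ℝ) ≤ t := hst
  have s0 := s.2.1
  have t1 := t.2.2
  let F : ℝ → Limit := fun x => point (Set.projIcc 0 1 zero_le_one x) c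
  have hF : ∀ τ : unitInterval, F τ = point τ c := fun τ => by
    simp only [F, Set.projIcc_val]
  have hmeas : Measurable fun x => g (F x) :=
    h.1.comp ((measurable_point_left c).comp continuous_projIcc.measurable)
  have hspeed : HasUnitSpeedOn (fun r => F (s + r)) (Set.Icc 0 ((t : ℝ) - s)) := by
    refine hasUnitSpeedOn_of_dist_eq fun x hx y hy => ?_
    simp only [F, dist_point]
    rw [Set.projIcc_of_mem _ (show (s : ℝ) + x ∈ Set.Icc (0 : ℝ) 1 from
        ⟨by linarith [hx.1], by linarith [hx.2]⟩),
      Set.projIcc_of_mem _ (show (s : ℝ) + y ∈ Set.Icc (0 : ℝ) 1 from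
        ⟨by linarith [hy.1], by linarith [hy.2]⟩)]
    simp
  have key := h.2 ((t : ℝ) - s) _ (by linarith) hspeed
  simp only [add_zero, add_sub_cancel, hF] at key
  refine key.trans (le_of_eq ?_)
  have e1 := (measurePreserving_add_left (volume : Measure ℝ) (s : ℝ)).setLIntegral_comp_preimage
    (measurableSet_Icc (a := (s : ℝ)) (b := t)) hmeas
  have e2 := unitInterval.measurePreserving_coe.setLIntegral_comp_preimage
    (measurableSet_Icc (a := (s : ℝ)) (b := t)) hmeas
  rw [Set.preimage_const_add_Icc, sub_self] at e1
  rw [Measure.restrict_restrict measurableSet_Icc, Set.inter_eq_left.2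
    (Set.Icc_subset_Icc s0 t1)] at e2
  rw [e1, ← e2, Set.uIcc_of_le hst]
  simp only [hF]
  rfl

theorem measurableSet_star (v : unitInterval) (b : ℕ → Bool) (ρ : ℝ) :
    MeasurableSet (star v b ρ) :=
  (measurableSet_abs_sub_le v ρ).prod (measurableSet_agree v b)

/-- The Poincaré inequality on stars: all points of a star are joined to its centre by monotone
geodesics, and the measure on the star is the product of the measure on the set of these geodesics
and the arclength. -/
theorem lintegral_star_le (w : Set.Ioo (0 : ℝ) 1) (h : IsUpperGradient g u) (v : unitInterval)
    (b : ℕ → Bool) (ρ : ℝ) :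
    ∫⁻ p in star v b ρ, ENNReal.ofReal |u (point p.1 p.2) - u (point v b)| ∂paramMeasure w ≤
      ENNReal.ofReal (2 * ρ) * ∫⁻ p in star v b ρ, g (point p.1 p.2) ∂paramMeasure w := by
  set I : Set unitInterval := {s | |(s : ℝ) - v| ≤ ρ} with hI
  set A : Set (ℕ → Bool) := {c | Agree v b c} with hA
  let G : (ℕ → Bool) → ℝ≥0∞ := fun c => ∫⁻ τ in I, g (point τ c)
  have hgm : Measurable fun p : unitInterval × (ℕ → Bool) => g (point p.1 p.2) :=
    h.1.comp measurable_point
  have hG : Measurable G := hgm.lintegral_prod_left'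
  have hrestrict : (paramMeasure w).restrict (star v b ρ) =
      (volume.restrict I).prod ((choiceMeasure w).restrict A) := (Measure.prod_restrict _ _).symm
  calc _ ≤ ∫⁻ p in star v b ρ, G p.2 ∂paramMeasure w := by
        refine setLIntegral_mono' (measurableSet_star v b ρ) ?_
        rintro ⟨s, c⟩ ⟨hs, hc⟩
        rw [point_eq_point (show Agree v b c from hc)]
        refine (ofReal_abs_sub_le h v s c).trans (lintegral_mono_set ?_)
        intro τ hτ
        have hs' : |(s : ℝ) - v| ≤ ρ := hs
        refine le_trans ?_ hs'
        rcases le_total v s with hvs | hvs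
        · rw [Set.uIcc_of_le hvs] at hτ
          have h1 : (v : ℝ) ≤ τ := hτ.1
          have h2 : (τ : ℝ) ≤ s := hτ.2
          rw [abs_of_nonneg (by linarith), abs_of_nonneg (by linarith)]
          linarith
        · rw [Set.uIcc_of_ge hvs] at hτ
          have h1 : (s : ℝ) ≤ τ := hτ.1
          have h2 : (τ : ℝ) ≤ v := hτ.2
          rw [abs_of_nonpos (by linarith), abs_of_nonpos (by linarith)]
          linarith
    _ = volume I * ∫⁻ c in A, G c ∂choiceMeasure w := by
        rw [hrestrict, lintegral_prod (fun p : unitInterval × (ℕ → Bool) => G p.2)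
          (hG.comp measurable_snd).aemeasurable]
        simp only [lintegral_const, Measure.restrict_apply_univ]
        rw [mul_comm]
    _ = volume I * ∫⁻ p in star v b ρ, g (point p.1 p.2) ∂paramMeasure w := by
        rw [hrestrict, lintegral_prod_symm _ hgm.aemeasurable]
    _ ≤ _ := mul_le_mul_left (volume_abs_sub_le v ρ) _

/-- The value `a` is that of `u` at the centre of a star that contains the ball. -/
theorem lintegral_ball_le (w : Set.Ioo (0 : ℝ) 1) (hu : LocallyIntegrable u (measure w))
    (h : IsUpperGradient g u) (x : Limit) {r : ℝ} (hr : 0 < r) :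
    ∃ a, ∫⁻ y in Metric.ball x r, ENNReal.ofReal |u y - a| ∂measure w ≤
      ENNReal.ofReal (16 * r) * ∫⁻ y in Metric.ball x (16 * r), g y ∂measure w := by
  obtain ⟨t, b, rfl⟩ := exists_point x
  obtain ⟨n, v, hv, hvt, hnr, hsub⟩ := exists_ball_subset_star t b hr
  have hsub' := star_subset_ball (t := t) (v := v) (b := b) (ρ := 1 / 4 ^ n) (r := 16 * r)
    (by linarith)
  refine ⟨u (point v b), ?_⟩
  have hrest : ∀ R, (measure w).restrict (Metric.ball (point t b) R) = ((paramMeasure w).restrict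
      ((fun p : unitInterval × (ℕ → Bool) => point p.1 p.2) ⁻¹' Metric.ball (point t b) R)).map
        fun p => point p.1 p.2 := fun R =>
    Measure.restrict_map measurable_point Metric.isOpen_ball.measurableSet
  have hum : AEMeasurable (fun y => ENNReal.ofReal |u y - u (point v b)|)
      ((measure w).restrict (Metric.ball (point t b) r)) :=
    ((hu.aestronglyMeasurable.aemeasurable.restrict.sub_const _).abs).ennreal_ofReal
  rw [hrest] at hum ⊢
  rw [hrest, lintegral_map' hum measurable_point.aemeasurable, lintegral_map h.1 measurable_point]
  calc _ ≤ ∫⁻ p in star v b (1 / 4 ^ n),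
        ENNReal.ofReal |u (point p.1 p.2) - u (point v b)| ∂paramMeasure w :=
        lintegral_mono_set hsub
    _ ≤ _ := lintegral_star_le w h v b _
    _ ≤ _ := mul_le_mul' (ENNReal.ofReal_le_ofReal (by linarith)) (lintegral_mono_set hsub')

theorem supportsPoincareOneOne (w : Set.Ioo (0 : ℝ) 1) : SupportsPoincareOneOne (measure w) := by
  obtain ⟨C, hC⟩ := isDoublingMeasure w
  refine ⟨32 * C ^ 4, 16, by norm_num, fun u g hu hg x r hr => ?_⟩
  obtain ⟨hpos, hfin, -⟩ := hC x r hr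
  obtain ⟨hpos16, hfin16, -⟩ := hC x (16 * r) (by linarith)
  have hdoub : measure w (Metric.ball x (16 * r)) ≤ C ^ 4 * measure w (Metric.ball x r) := by
    have h1 := (hC x r hr).2.2
    have h2 := (hC x (2 * r) (by linarith)).2.2
    have h3 := (hC x (2 * (2 * r)) (by linarith)).2.2
    have h4 := (hC x (2 * (2 * (2 * r))) (by linarith)).2.2
    rw [show 16 * r = 2 * (2 * (2 * (2 * r))) by ring]
    calc _ ≤ _ := h4
      _ ≤ C * (C * (C * (C * measure w (Metric.ball x r)))) := by
        gcongr
        exact h3.trans (by gcongr; exact h2.trans (by gcongr))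
      _ = _ := by ring
  have hint : Integrable u (measure w) :=
    integrableOn_univ.1 (hu.integrableOn_isCompact isCompact_univ)
  obtain ⟨a, ha⟩ := lintegral_ball_le w hu hg x hr
  have hne : measure w (Metric.ball x r) ≠ 0 := hpos.ne'
  have hprob : IsProbabilityMeasure ((((measure w).restrict (Metric.ball x r)) Set.univ)⁻¹ •
      (measure w).restrict (Metric.ball x r)) := by
    have : NeZero ((measure w).restrict (Metric.ball x r)) :=
      ⟨fun h0 => hne (by rw [← Measure.restrict_apply_univ, h0]; rfl)⟩
    infer_instance
  have hint' : Integrable u ((((measure w).restrict (Metric.ball x r)) Set.univ)⁻¹ •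
      (measure w).restrict (Metric.ball x r)) :=
    hint.restrict.smul_measure (by simpa using hne)
  calc _ ≤ 2 * ⨍⁻ y in Metric.ball x r, ENNReal.ofReal |u y - a| ∂measure w :=
        lintegral_abs_sub_integral_le hint' a
    _ ≤ 2 * ((ENNReal.ofReal (16 * r) * ∫⁻ y in Metric.ball x (16 * r), g y ∂measure w) /
          measure w (Metric.ball x r)) := by
        rw [setLAverage_eq]
        gcongr
    _ ≤ 2 * (ENNReal.ofReal (16 * r) *
          (C ^ 4 * ⨍⁻ y in Metric.ball x (16 * r), g y ∂measure w)) := by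
        rw [setLAverage_eq, mul_div_assoc]
        gcongr
        rw [ENNReal.div_le_iff hne hfin.ne, ENNReal.div_eq_inv_mul]
        set J := ∫⁻ y in Metric.ball x (16 * r), g y ∂measure w
        calc J = measure w (Metric.ball x (16 * r)) *
                (measure w (Metric.ball x (16 * r)))⁻¹ * J := by
              rw [ENNReal.mul_inv_cancel hpos16.ne' hfin16.ne, one_mul]
          _ ≤ C ^ 4 * measure w (Metric.ball x r) * (measure w (Metric.ball x (16 * r)))⁻¹ * J := by
              gcongr
          _ = _ := by ring
    _ = _ := by
        rw [ENNReal.ofReal_mul (by norm_num)]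
        push_cast
        rw [ENNReal.ofReal_ofNat]
        ring

end Limit

end Laakso

namespace Laakso

open LenGraph ProbabilityTheory

/-! ### Mutual singularity -/

theorem isOpen_mid (n : ℕ) : IsOpen {t | Mid n t} := by
  have : {t | Mid n t} = ⋃ m : ℤ, {t : unitInterval | (m : ℝ) + 1 / 4 < 4 ^ n * t} ∩
      {t : unitInterval | 4 ^ n * (t : ℝ) < m + 3 / 4} := by
    ext t
    simp [mid_iff]
  rw [this]
  exact isOpen_iUnion fun m => (isOpen_lt (by fun_prop) (by fun_prop)).inter
    (isOpen_lt (by fun_prop) (by fun_prop))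

theorem measurePreserving_stretch : MeasurePreserving stretch := by
  refine ⟨measurable_stretch, Measure.ext fun S hS => ?_⟩
  rw [Measure.map_apply measurable_stretch hS, ← lintegral_indicator_one hS,
    ← lintegral_indicator_one (measurable_stretch hS)]
  have := lintegral_digit_stretch (f := fun _ => S.indicator 1) fun _ =>
    measurable_one.indicator hS
  rw [Finset.sum_const, Finset.card_univ, Fintype.card_fin, nsmul_eq_mul, ← mul_assoc,
    ← ENNReal.ofReal_natCast, ← ENNReal.ofReal_mul (by norm_num)] at this
  norm_num at this
  exact this

theorem measurePreserving_posAt (n : ℕ) : MeasurePreserving (posAt n) := by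
  induction n with
  | zero => exact MeasurePreserving.id _
  | succ n ih => exact measurePreserving_stretch.comp ih

theorem posAt_add (n k : ℕ) (t : unitInterval) : posAt (n + k) t = posAt k (posAt n t) := by
  induction k with
  | zero => rfl
  | succ k ih => rw [← add_assoc, posAt, ih, posAt]

theorem mid_zero_iff {s : unitInterval} (hs : (s : ℝ) ≠ 1 / 4) :
    Mid 0 s ↔ digit s = 1 ∨ digit s = 2 := by
  rw [Mid, posAt]
  unfold digit
  constructor
  · rintro ⟨h0, h1⟩
    rw [if_neg (by linarith)]
    split_ifs
    exacts [.inl rfl, .inr rfl]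
  · split_ifs with h h' h''
    · simp
    · exact fun _ => ⟨lt_of_le_of_ne (not_lt.1 h) hs.symm, by linarith⟩
    · exact fun _ => ⟨lt_of_le_of_ne (not_lt.1 h) hs.symm, h''⟩
    · simp

/-- Lying in one of the two middle quarters is independent of the coordinate in the quarter. -/
theorem volume_mid_zero_inter {S : Set unitInterval} (hS : MeasurableSet S) :
    (volume : Measure unitInterval) ({t | Mid 0 t} ∩ stretch ⁻¹' S) = 2⁻¹ * volume S := by
  have hm : MeasurableSet ({t | Mid 0 t} ∩ stretch ⁻¹' S) :=
    (isOpen_mid 0).measurableSet.inter (measurable_stretch hS)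
  let f : Fin 4 → unitInterval → ℝ≥0∞ := ![0, S.indicator 1, S.indicator 1, 0]
  have hS' : Measurable (S.indicator (1 : unitInterval → ℝ≥0∞)) := measurable_one.indicator hS
  have hf : ∀ d, Measurable (f d) := by
    intro d
    fin_cases d
    exacts [measurable_zero, hS', hS', measurable_zero]
  have hae : ∀ᵐ t : unitInterval,
      ({t | Mid 0 t} ∩ stretch ⁻¹' S).indicator 1 t = f (digit t) (stretch t) := by
    have : ∀ᵐ t : unitInterval, t ≠ ⟨1 / 4, by norm_num, by norm_num⟩ := by simp [ae_iff]
    filter_upwards [this] with t ht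
    have ht' : (t : ℝ) ≠ 1 / 4 := fun h => ht (Subtype.ext h)
    have hmem : t ∈ {t | Mid 0 t} ∩ stretch ⁻¹' S ↔
        (digit t = 1 ∨ digit t = 2) ∧ stretch t ∈ S := and_congr_left' (mid_zero_iff ht')
    classical
    rw [Set.indicator_apply, if_congr hmem rfl rfl]
    generalize digit t = d
    fin_cases d <;> simp [f, Set.indicator_apply]
  rw [← lintegral_indicator_one hm, lintegral_congr_ae hae, lintegral_digit_stretch hf]
  simp only [Fin.sum_univ_four, f, Matrix.cons_val, Pi.zero_apply, lintegral_zero, mul_zero,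
    zero_add, add_zero]
  rw [lintegral_indicator_one hS, ← add_mul, ← ENNReal.ofReal_add (by norm_num) (by norm_num)]
  norm_num
  rw [ENNReal.ofReal_div_of_pos (by norm_num)]
  simp

theorem volume_mid (n : ℕ) : (volume : Measure unitInterval) {t | Mid n t} = 2⁻¹ := by
  have h := volume_mid_zero_inter MeasurableSet.univ
  rw [Set.preimage_univ, Set.inter_univ, measure_univ, mul_one] at h
  rw [← h]
  exact (measurePreserving_posAt n).measure_preimage (isOpen_mid 0).measurableSet.nullMeasurableSet

theorem volume_mid_inter_mid {n m : ℕ} (h : n < m) :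
    (volume : Measure unitInterval) ({t | Mid n t} ∩ {t | Mid m t}) = 2⁻¹ * 2⁻¹ := by
  obtain ⟨k, rfl⟩ := Nat.exists_eq_add_of_lt h
  have hset : {t | Mid n t} ∩ {t | Mid (n + k + 1) t} =
      posAt n ⁻¹' ({t | Mid 0 t} ∩ stretch ⁻¹' {t | Mid k t}) := by
    ext t
    have : posAt (n + k + 1) t = posAt k (stretch (posAt n t)) := by
      rw [show n + k + 1 = (n + 1) + k by ring, posAt_add]
      rfl
    change Mid n t ∧ Mid (n + k + 1) t ↔ Mid n t ∧ Mid k (stretch (posAt n t))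
    refine and_congr_right' ?_
    rw [Mid, this]
    rfl
  rw [hset, (measurePreserving_posAt n).measure_preimage
    ((isOpen_mid 0).measurableSet.inter
      (measurable_stretch (isOpen_mid k).measurableSet)).nullMeasurableSet,
    volume_mid_zero_inter (isOpen_mid k).measurableSet, volume_mid]

/-- The parameters of the points that lie strictly inside the top branch of a diamond of
generation `n`. -/
def topParam (n : ℕ) : Set (unitInterval × (ℕ → Bool)) := {t | Mid n t} ×ˢ {b | b n = true}

theorem measurableSet_eval_eq (n : ℕ) : MeasurableSet {b : ℕ → Bool | b n = true} :=
  (measurable_pi_apply n : Measurable fun b : ℕ → Bool => b n) (measurableSet_singleton true)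

theorem measurableSet_topParam (n : ℕ) : MeasurableSet (topParam n) :=
  (isOpen_mid n).measurableSet.prod (measurableSet_eval_eq n)

theorem choiceMeasure_top (w : Set.Ioo (0 : ℝ) 1) (n : ℕ) :
    choiceMeasure w {b | b n = true} = ENNReal.ofReal w := by
  have : {b : ℕ → Bool | b n = true} = (({n} : Finset ℕ) : Set ℕ).pi fun _ => {true} := by
    ext b
    simp
  rw [this, choiceMeasure, Measure.infinitePi_pi _ fun _ _ => measurableSet_singleton _,
    Finset.prod_singleton, branchMeasure_singleton, if_pos rfl]

theorem choiceMeasure_top_inter_top (w : Set.Ioo (0 : ℝ) 1) {n m : ℕ} (h : n ≠ m) :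
    choiceMeasure w ({b | b n = true} ∩ {b | b m = true}) =
      ENNReal.ofReal w * ENNReal.ofReal w := by
  have : {b : ℕ → Bool | b n = true} ∩ {b | b m = true} =
      (({n, m} : Finset ℕ) : Set ℕ).pi fun _ => {true} := by
    ext b
    simp
  rw [this, choiceMeasure, Measure.infinitePi_pi _ fun _ _ => measurableSet_singleton _,
    Finset.prod_pair h, branchMeasure_singleton, if_pos rfl]

theorem paramMeasure_topParam (w : Set.Ioo (0 : ℝ) 1) (n : ℕ) :
    paramMeasure w (topParam n) = 2⁻¹ * ENNReal.ofReal w := by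
  rw [paramMeasure, topParam, Measure.prod_prod, volume_mid, choiceMeasure_top]

theorem indepSet_topParam (w : Set.Ioo (0 : ℝ) 1) {n m : ℕ} (h : n ≠ m) :
    IndepSet (topParam n) (topParam m) (paramMeasure w) := by
  wlog hlt : n < m generalizing n m
  · exact (this h.symm (by omega)).symm
  rw [indepSet_iff_measure_inter_eq_mul (measurableSet_topParam n) (measurableSet_topParam m)
      (paramMeasure w),
    paramMeasure_topParam, paramMeasure_topParam, topParam, topParam, Set.prod_inter_prod,
    paramMeasure, Measure.prod_prod, volume_mid_inter_mid hlt, choiceMeasure_top_inter_top w h]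
  ring

theorem indepFun_indicator {Ω : Type*} [MeasurableSpace Ω] {P : Measure Ω} {s t : Set Ω}
    (h : IndepSet s t P) :
    IndepFun (s.indicator fun _ => (1 : ℝ)) (t.indicator fun _ => (1 : ℝ)) P := by
  refine indep_of_indep_of_le_left (indep_of_indep_of_le_right h ?_) ?_
  · exact Measurable.comap_le (measurable_const.indicator
      (MeasurableSpace.measurableSet_generateFrom (Set.mem_singleton t)))
  · exact Measurable.comap_le (measurable_const.indicator
      (MeasurableSpace.measurableSet_generateFrom (Set.mem_singleton s)))

/-- The law of the top branch indicator does not depend on the generation. -/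
theorem identDistrib_topParam (w : Set.Ioo (0 : ℝ) 1) (n : ℕ) :
    IdentDistrib ((topParam n).indicator fun _ => (1 : ℝ))
      ((topParam 0).indicator fun _ => (1 : ℝ)) (paramMeasure w) (paramMeasure w) := by
  have hp : ∀ k, MeasurePreserving (Prod.map (posAt k) fun b : ℕ → Bool => b k) (paramMeasure w)
      (volume.prod (branchMeasure w)) := fun k =>
    (measurePreserving_posAt k).prod (measurePreserving_eval_infinitePi _ k)
  have hid : IdentDistrib (Prod.map (posAt n) fun b : ℕ → Bool => b n)
      (Prod.map (posAt 0) fun b : ℕ → Bool => b 0) (paramMeasure w) (paramMeasure w) :=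
    ⟨(hp n).aemeasurable, (hp 0).aemeasurable, (hp n).map_eq.trans (hp 0).map_eq.symm⟩
  have hS : MeasurableSet ({t | Mid 0 t} ×ˢ ({true} : Set Bool)) :=
    (isOpen_mid 0).measurableSet.prod (measurableSet_singleton _)
  exact hid.comp (u := ({t | Mid 0 t} ×ˢ ({true} : Set Bool)).indicator fun _ => (1 : ℝ))
    (measurable_const.indicator hS)

/-- By the law of large numbers, almost every point lies in the top branches of diamonds with
frequency `w / 2`. -/
theorem ae_tendsto_topParam (w : Set.Ioo (0 : ℝ) 1) : ∀ᵐ p ∂paramMeasure w,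
    Tendsto (fun n : ℕ => (∑ i ∈ Finset.range n, (topParam i).indicator (fun _ => (1 : ℝ)) p) / n)
      atTop (𝓝 (w / 2)) := by
  have h := strong_law_ae_real (μ := paramMeasure w)
    (fun i => (topParam i).indicator fun _ => (1 : ℝ))
    ((integrable_const _).indicator (measurableSet_topParam 0))
    (fun i j hij => indepFun_indicator (indepSet_topParam w hij)) (identDistrib_topParam w)
  have he : ∫ p, (topParam 0).indicator (fun _ => (1 : ℝ)) p ∂paramMeasure w = w / 2 := by
    rw [integral_indicator_const _ (measurableSet_topParam 0), measureReal_def,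
      paramMeasure_topParam, ENNReal.toReal_mul, ENNReal.toReal_ofReal w.2.1.le, smul_eq_mul,
      mul_one, ENNReal.toReal_inv, ENNReal.toReal_ofNat]
    ring
  rwa [he] at h

namespace Limit

/-- The points that lie strictly inside the top branch of a diamond of generation `n`. -/
def top (n : ℕ) : Set Limit := (fun p : unitInterval × (ℕ → Bool) => point p.1 p.2) '' topParam n

theorem point_mem_top_iff {n : ℕ} {t : unitInterval} {b : ℕ → Bool} :
    point t b ∈ top n ↔ (t, b) ∈ topParam n := by
  refine ⟨?_, fun h => ⟨_, h, rfl⟩⟩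
  rintro ⟨⟨s, c⟩, ⟨hs, hc⟩, h⟩
  obtain ⟨hst, hag⟩ := point_eq_point_iff.1 h
  obtain rfl : s = t := hst
  exact ⟨hs, ((hag n).resolve_right (not_not.2 hs)).symm.trans hc⟩

theorem measurableSet_top (n : ℕ) : MeasurableSet (top n) := by
  let Φ := fun p : unitInterval × (ℕ → Bool) => point p.1 p.2
  have h1 : IsClosed {p : unitInterval × (ℕ → Bool) | p.2 n = true} :=
    isClosed_singleton.preimage ((continuous_apply n).comp continuous_snd)
  have h2 : IsClosed {p : unitInterval × (ℕ → Bool) | ¬ Mid n p.1} :=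
    (isOpen_mid n).isClosed_compl.preimage continuous_fst
  have h : top n = Φ '' {p | p.2 n = true} \ Φ '' {p | ¬ Mid n p.1} := by
    ext x
    constructor
    · rintro ⟨⟨t, b⟩, ⟨ht, hb⟩, rfl⟩
      refine ⟨⟨(t, b), hb, rfl⟩, ?_⟩
      rintro ⟨⟨s, c⟩, hs, hsc⟩
      obtain rfl : s = t := (point_eq_point_iff.1 hsc).1
      exact hs ht
    · rintro ⟨⟨⟨t, b⟩, hb, rfl⟩, h⟩
      exact ⟨(t, b), ⟨by_contra fun ht => h ⟨(t, b), ht, rfl⟩, hb⟩, rfl⟩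
  rw [h]
  exact (h1.isCompact.image continuous_point).measurableSet.diff
    (h2.isCompact.image continuous_point).measurableSet

theorem ae_tendsto_top (w : Set.Ioo (0 : ℝ) 1) : ∀ᵐ x ∂measure w,
    Tendsto (fun n : ℕ => (∑ i ∈ Finset.range n, (top i).indicator (fun _ => (1 : ℝ)) x) / n)
      atTop (𝓝 (w / 2)) := by
  have hm : MeasurableSet {x | Tendsto (fun n : ℕ => (∑ i ∈ Finset.range n,
      (top i).indicator (fun _ => (1 : ℝ)) x) / n) atTop (𝓝 ((w : ℝ) / 2))} :=
    measurableSet_tendsto _ fun n => (Finset.measurable_fun_sum _ fun i _ =>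
      measurable_const.indicator (measurableSet_top i)).div_const _
  rw [measure, ae_map_iff measurable_point.aemeasurable hm]
  filter_upwards [ae_tendsto_topParam w] with p hp
  have hind : ∀ i, (top i).indicator (fun _ => (1 : ℝ)) (point p.1 p.2) =
      (topParam i).indicator (fun _ => (1 : ℝ)) p := fun i => by
    classical
    rw [Set.indicator_apply, Set.indicator_apply, if_congr point_mem_top_iff rfl rfl]
  simpa only [hind] using hp

theorem mutuallySingular {w w' : Set.Ioo (0 : ℝ) 1} (h : w ≠ w') : measure w ⟂ₘ measure w' := by
  refine Measure.MutuallySingular.mk (ae_tendsto_top w) (ae_tendsto_top w') fun x _ => ?_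
  by_contra hx
  rw [Set.mem_union, not_or] at hx
  have := tendsto_nhds_unique (not_not.1 hx.1) (not_not.1 hx.2)
  exact h (Subtype.ext (by linarith))

end Limit

end Laakso

theorem theorem1p1 :
    ∃ (X : Type) (_ : MetricSpace X) (_ : MeasurableSpace X) (_ : BorelSpace X)
      (π : ∀ n, X → (Laakso.graph n).Space) (μ : Set.Ioo (0 : ℝ) 1 → Measure X),
      Laakso.IsLimit X π ∧ CompactSpace X ∧ IsGeodesicSpace X ∧
      (∀ w, IsProbabilityMeasure (μ w) ∧
        (∀ n, (μ w).map (π n) = Laakso.graphMeasure w n) ∧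
        IsDoublingMeasure (μ w) ∧ SupportsPoincareOneOne (μ w)) ∧
      ∀ w w', w ≠ w' → μ w ⟂ₘ μ w' :=
  ⟨Laakso.Limit, inferInstance, inferInstance, inferInstance, Laakso.Limit.coord,
    Laakso.Limit.measure, Laakso.Limit.isLimit, inferInstance, Laakso.Limit.isGeodesicSpace,
    fun w => ⟨inferInstance, Laakso.Limit.map_coord_measure w, Laakso.Limit.isDoublingMeasure w,
      Laakso.Limit.supportsPoincareOneOne w⟩, fun _ _ => Laakso.Limit.mutuallySingular⟩
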